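/- **Theorem 1 (Contrastive estimation of non-linear dynamics).** Let $f:\mathbb{R}^d\to\mathbb{R}^d$ be a continuous bijection, $g:\mathbb{R}^d\to\mathbb{R}^D$ injective (and measurable), and let latents and observations be generated by $$x_{t+1}=f(x_t)+\varepsilon_t,\qquad y_t=g(x_t),\qquad t=0,1,2,\dots,$$ where the $\varepsilon_t$ are i.i.d. $\mathcal N(0,\Sigma_\varepsilon)$ with $\Sigma_\varepsilon$ positive definite, independent of the initial state $x_0$ (of arbitrary law). Assume that the data marginal exists in the limit: the time-averaged laws $\frac1T\sum_{t=0}^{T-1}\mathrm{Law}(x_t)$ converge weakly, as $T\to\infty$, to a probability distribution with continuous density $q$. Let $M\ge 1$ be the number of negative examples. For a real function $\psi$ of two observations put $$-\log p_\psi(y\mid y^+,N)=-\psi(y,y^+)+\log\Big(e^{\psi(y,y^+)}+\sum_{m=1}^M e^{\psi(y,y^-_m)}\Big),\qquad N=(y_1^-,\dots,y_M^-),$$ and let the InfoNCE loss on the time series be $$\mathcal L_T[\psi]=\frac1{T^{M+1}}\sum_{t,t_1,\dots,t_M=0}^{T-1}-\log p_\psi\big(y_t\mid y_{t+1},(y_{t_1},\dots,y_{t_M})\big),$$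 with reference $y_t$, positive example $y_{t+1}$ and negative examples $y_{t_1},\dots,y_{t_M}$. Write $\mathcal L[\psi]=l$ if $\mathcal L_T[\psi]\to l\in\mathbb{R}$ in probability as $T\to\infty$. Consider a model $\psi(y,y')=-\|\hat f(h(y))-h(y')\|^2-\alpha(y')$ with encoder $h:\mathbb{R}^D\to\mathbb{R}^d$, dynamics model $\hat f:\mathbb{R}^d\to\mathbb{R}^d$ and correction term $\alpha:\mathbb{R}^D\to\mathbb{R}$, where $\hat f$ and $h\circ g$ are continuous and the correction term is the log-density of the marginal, $\alpha(g(x))=\log q(x)$ for all $x$. Suppose that $\psi$ attains the global minimum of the loss in the limit $T\to\infty$: $\mathcal L[\psi]$ exists, and $\mathcal L[\psi]\le\mathcal L[\psi']$ for every measurable $\psi':\mathbb{R}^D\times\mathbb{R}^D\to\mathbb{R}$ for which $\mathcal L[\psi']$ exists. Then $q>0$ everywhere, i.e. the support of the data marginal is all of $\mathbb{R}^d$, and there are an orthogonal matrix $Q\in\mathbb{R}^{d\times d}$ and $b\in\mathbb{R}^d$ such that, with the invertible matrix $L=\tfrac1{\sqrt2}\,Q\,\Sigma_\varepsilon^{-1/2}$: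 (a) $h(g(x))=Lx+b$ for all $x\in\mathbb{R}^d$, and this is a bijective affine map; (b) $\hat f$ is bijective and $\hat f(x)=L\,f(L^{-1}(x-b))+b$ for all $x\in\mathbb{R}^d$. -/

import Mathlib

open MeasureTheory ProbabilityTheory Filter Topology

noncomputable section

/-- `S ^ (-1/2)` for a positive definite matrix `S`: the inverse of its positive semidefinite
square root. -/
def invSqrt {d : ℕ} (S : Matrix (Fin d) (Fin d) ℝ) : Matrix (Fin d) (Fin d) ℝ :=
  open scoped MatrixOrder in (CFC.sqrt S)⁻¹

/-- The data-generating process `x (t+1) = f (x t) + ε t`, `y t = g (x t)`, with i.i.d. noise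
`ε t ∼ N(0, S)` that is independent of the initial state `x 0` (whose law is arbitrary). -/
structure DataGeneratingProcess {Ω : Type*} [MeasurableSpace Ω] (P : Measure Ω) {d D : ℕ}
    (f : EuclideanSpace ℝ (Fin d) → EuclideanSpace ℝ (Fin d))
    (g : EuclideanSpace ℝ (Fin d) → EuclideanSpace ℝ (Fin D))
    (S : Matrix (Fin d) (Fin d) ℝ)
    (x : ℕ → Ω → EuclideanSpace ℝ (Fin d)) (ε : ℕ → Ω → EuclideanSpace ℝ (Fin d))
    (y : ℕ → Ω → EuclideanSpace ℝ (Fin D)) : Prop where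
  measurable_init : Measurable (x 0)
  measurable_noise : ∀ t, Measurable (ε t)
  noise_law : ∀ t, P.map (ε t) = multivariateGaussian 0 S
  noise_indep : iIndepFun ε P
  init_indep : IndepFun (x 0) (fun ω t => ε t ω) P
  dynamics : ∀ t ω, x (t + 1) ω = f (x t ω) + ε t ω
  observation : ∀ t ω, y t ω = g (x t ω)

/-- `q` is the continuous density of the limiting data marginal distribution: the law of `x t`, for
`t` uniform on `{0, …, T-1}`, converges weakly to `q(z) dz` as `T → ∞`. (The test function `1`
shows that `q` has integral one.) -/
structure IsLimitMarginalDensity {Ω : Type*} [MeasurableSpace Ω] (P : Measure Ω) {d : ℕ}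
    (x : ℕ → Ω → EuclideanSpace ℝ (Fin d)) (q : EuclideanSpace ℝ (Fin d) → ℝ) : Prop where
  continuous : Continuous q
  nonneg : ∀ z, 0 ≤ q z
  tendsto : ∀ φ : BoundedContinuousFunction (EuclideanSpace ℝ (Fin d)) ℝ,
    Tendsto (fun T : ℕ => (∑ t ∈ Finset.range T, ∫ ω, φ (x t ω) ∂P) / (T : ℝ)) atTop
      (𝓝 (∫ z, φ z * q z))

/-- The log-likelihood `log p_ψ(y | y⁺, N)` with `M` negative examples. -/
def logLikelihood {Y : Type*} {M : ℕ} (ψ : Y → Y → ℝ) (y yPos : Y) (N : Fin M → Y) : ℝ :=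
  ψ y yPos - Real.log (Real.exp (ψ y yPos) + ∑ m, Real.exp (ψ y (N m)))

/-- The InfoNCE loss of `ψ` on a time series: the mean of `-log p_ψ` over independent uniform time
indices `t, t₁, …, t_M` in `{0, …, T-1}`, with reference `y t`, positive example `y (t+1)` and
negative examples `y t₁, …, y t_M`. -/
def infoNCELoss {Y : Type*} (M T : ℕ) (ψ : Y → Y → ℝ) (y : ℕ → Y) : ℝ :=
  (∑ t : Fin T, ∑ τ : Fin M → Fin T,
    -logLikelihood ψ (y (t : ℕ)) (y ((t : ℕ) + 1)) (fun m => y (τ m : ℕ))) / (T : ℝ) ^ (M + 1)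

/-- As `T → ∞`, the InfoNCE loss of `ψ` on the random time series `y` converges in probability to
the number `l`. -/
def HasAsymptoticLoss {Ω : Type*} [MeasurableSpace Ω] (P : Measure Ω) {Y : Type*} (M : ℕ)
    (y : ℕ → Ω → Y) (ψ : Y → Y → ℝ) (l : ℝ) : Prop :=
  TendstoInMeasure P (fun T ω => infoNCELoss M T ψ (fun t => y t ω)) atTop (fun _ => l)

/-- `ψ` attains the global minimum, over all measurable functions of two observations, of the
InfoNCE loss in the limit `T → ∞`. -/
def AttainsGlobalMinimum {Ω : Type*} [MeasurableSpace Ω] (P : Measure Ω) {Y : Type*}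
    [MeasurableSpace Y] (M : ℕ) (y : ℕ → Ω → Y) (ψ : Y → Y → ℝ) : Prop :=
  ∃ l : ℝ, HasAsymptoticLoss P M y ψ l ∧
    ∀ ψ' : Y → Y → ℝ, Measurable (Function.uncurry ψ') →
      ∀ l' : ℝ, HasAsymptoticLoss P M y ψ' l' → l ≤ l'

/-- The model `ψ(y, y') = -‖f̂(h(y)) - h(y')‖² - α(y')`. -/
def dclModel {d D : ℕ} (h : EuclideanSpace ℝ (Fin D) → EuclideanSpace ℝ (Fin d))
    (fhat : EuclideanSpace ℝ (Fin d) → EuclideanSpace ℝ (Fin d))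
    (α : EuclideanSpace ℝ (Fin D) → ℝ) (y y' : EuclideanSpace ℝ (Fin D)) : ℝ :=
  -‖fhat (h y) - h y'‖ ^ 2 - α y'

end

/-!
Let `μ = q dz` be the limit marginal distribution, `κ` the density of the noise, and `ρ` the law of
`(x, f x + e)` for independent `x ∼ μ` and noise `e`.

*The marginal is positive.* As a limit of time-averaged laws, `μ` is invariant
(`IsNoisyOrbit.oneStepLaw_map_snd`), so `q z = ∫ κ (z - f x) dμ(x) > 0` (`density_pos`). Hence `ρ`
has the positive density `r (x, z) = κ (z - f x) / q z` relative to `μ × μ`.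

*Time averages converge.* Square integrable functions orthogonal to all coboundaries `w - K w`,
where `K` is the transition operator, are constant, since every pair of points is a possible
transition (`eq_zero_of_orthogonal_coboundary`). So every bounded continuous function is, up to a
small error in `L¹(μ)`, a constant plus a coboundary; averages of coboundaries telescope up to
martingale increments, and the assumed weak convergence controls the error along the orbit. This
gives a law of large numbers in probability for any law of the initial state
(`IsNoisyOrbit.tendsto_average`). Since products of probability measures depend continuously on
their factors in the weak topology, it extends to averages over one transition and `M` independent
times, with limit `ρ × μ^M` (`IsNoisyOrbit.tendsto_average_pi`).

*First-order condition.* The loss of `ψ` itself is unbounded, and only its existence is known. But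
adding a bounded continuous `η` changes it by an average of a bounded continuous function, so the
loss of `ψ + η` exists and is not smaller (`integral_lossChange_nonneg`). With
`η = arctan (log r - ψ)` and an exchange of the positive example with a negative one, the derivative
of the loss is an integral of nonpositive terms. They must vanish, so `log r - ψ` depends on the
reference only (`log_density_sub_eq_of_forall_lossChange_nonneg`).

*Rigidity.* As `ψ` contains the correction `log q`, this says that
`½ ‖S ^ (-1/2) (z - f x)‖² - ‖fhat (h (g x)) - h (g z)‖²` depends on `x` only. Since `f` is onto,
polarization shows that `h ∘ g` and `fhat ∘ h ∘ g ∘ f⁻¹` are the same isometry in the coordinates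
`2 ^ (-1/2) S ^ (-1/2) z` (`exists_isometry_of_sq_dist_eq`).
-/

open scoped BoundedContinuousFunction ENNReal

/-! ### Convergence in probability as a filter, and empirical measures -/

/-- The filter of convergence in probability of random sequences: a property of `(T, ω)` holds
eventually if its failure has probability tending to `0` as `T → ∞`. -/
def inProbability {Ω : Type*} [MeasurableSpace Ω] (P : Measure Ω) : Filter (ℕ × Ω) where
  sets := {A | Tendsto (fun T => P {ω | (T, ω) ∉ A}) atTop (𝓝 0)}
  univ_sets := by simp
  sets_of_superset := by
    intro A B hA hAB
    exact tendsto_of_tendsto_of_tendsto_of_le_of_le tendsto_const_nhds hA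
      (fun _ => zero_le) (fun T => measure_mono fun ω hω h => hω (hAB h))
  inter_sets := by
    intro A B hA hB
    have := Tendsto.add hA hB
    rw [add_zero] at this
    refine tendsto_of_tendsto_of_tendsto_of_le_of_le tendsto_const_nhds this
      (fun _ => zero_le) (fun T => ?_)
    refine (measure_mono ?_).trans (measure_union_le _ _)
    intro ω hω
    by_contra hc
    simp only [Set.mem_union, Set.mem_ofPred_eq, not_or, not_not] at hc
    exact hω hc

section InProbability

variable {Ω : Type*} [MeasurableSpace Ω] {P : Measure Ω}

lemma mem_inProbability {A : Set (ℕ × Ω)} :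
    A ∈ inProbability P ↔ Tendsto (fun T => P {ω | (T, ω) ∉ A}) atTop (𝓝 0) := Iff.rfl

lemma tendsto_fst_inProbability : Tendsto Prod.fst (inProbability P) atTop := by
  rw [tendsto_atTop]
  intro b
  refine mem_inProbability.2 (tendsto_const_nhds.congr' ?_)
  filter_upwards [eventually_ge_atTop b] with T hT
  simp [hT]

lemma tendstoInMeasure_const_iff {F : ℕ → Ω → ℝ} {c : ℝ} :
    TendstoInMeasure P F atTop (fun _ => c) ↔
      Tendsto (fun p : ℕ × Ω => F p.1 p.2) (inProbability P) (𝓝 c) := by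
  rw [EMetric.tendsto_nhds]
  refine forall_congr' fun ε => imp_congr_right fun _ => ?_
  rw [Filter.Eventually, mem_inProbability]
  simp

/-- Convergence in mean, in a form that only bounds the limit superior of the `L¹` errors,
implies convergence in probability. -/
lemma tendsto_inProbability_of_integral_le {F : ℕ → Ω → ℝ} {c : ℝ}
    (hint : ∀ T, Integrable (fun ω => F T ω - c) P)
    (h : ∀ δ > 0, ∀ᶠ T in atTop, ∫ ω, |F T ω - c| ∂P ≤ δ) :
    Tendsto (fun p : ℕ × Ω => F p.1 p.2) (inProbability P) (𝓝 c) := by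
  rw [← tendstoInMeasure_const_iff]
  have hF : ∀ T, AEStronglyMeasurable (F T) P := fun T => by
    refine ((hint T).1.add (aestronglyMeasurable_const (b := c))).congr (.of_forall fun ω => ?_)
    simp
  refine tendstoInMeasure_of_tendsto_eLpNorm one_ne_zero hF aestronglyMeasurable_const ?_
  have hreal : Tendsto (fun T => ∫ ω, |F T ω - c| ∂P) atTop (𝓝 0) := by
    rw [Metric.tendsto_nhds]
    intro δ hδ
    filter_upwards [h (δ / 2) (half_pos hδ)] with T hT
    rw [Real.dist_0_eq_abs, abs_of_nonneg (integral_nonneg fun _ => abs_nonneg _)]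
    linarith
  have := ENNReal.tendsto_ofReal hreal
  rw [ENNReal.ofReal_zero] at this
  refine this.congr fun T => ?_
  rw [eLpNorm_one_eq_lintegral_enorm]
  exact ofReal_integral_norm_eq_lintegral_enorm (hint T)

end InProbability

section Empirical

variable {α : Type*} [MeasurableSpace α]

/-- The uniform distribution on `Fin T` (the zero measure if `T = 0`). -/
noncomputable def uniformFin (T : ℕ) : Measure (Fin T) := (T : ℝ≥0∞)⁻¹ • Measure.count

lemma uniformFin_real_singleton (T : ℕ) (t : Fin T) : (uniformFin T).real {t} = (T : ℝ)⁻¹ := by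
  simp [uniformFin, Measure.real]

instance (T : ℕ) [NeZero T] : IsProbabilityMeasure (uniformFin T) where
  measure_univ := by
    simp [uniformFin, Measure.count_apply_finite]
    exact ENNReal.inv_mul_cancel (by exact_mod_cast NeZero.ne T) (by simp)

instance (T : ℕ) : IsFiniteMeasure (uniformFin T) := by
  rcases Nat.eq_zero_or_pos T with rfl | h
  · exact ⟨by simp [uniformFin]⟩
  · have : NeZero T := ⟨h.ne'⟩
    infer_instance

/-- The empirical distribution of the first `T` terms of a sequence, made a Dirac mass for
`T = 0` so that it is always a probability measure. -/
noncomputable def empiricalMeasure (u : ℕ → α) (T : ℕ) : ProbabilityMeasure α :=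
  if h : T = 0 then ⟨Measure.dirac (u 0), inferInstance⟩
  else ⟨(uniformFin T).map (fun t : Fin T => u t), by
    have : NeZero T := ⟨h⟩
    exact Measure.isProbabilityMeasure_map (measurable_of_finite _).aemeasurable⟩

lemma empiricalMeasure_toMeasure (u : ℕ → α) {T : ℕ} (hT : T ≠ 0) :
    (empiricalMeasure u T : Measure α) = (uniformFin T).map (fun t : Fin T => u t) := by
  simp [empiricalMeasure, hT]

lemma integral_empiricalMeasure [TopologicalSpace α] [OpensMeasurableSpace α]
    (u : ℕ → α) {T : ℕ} (hT : T ≠ 0) (φ : α →ᵇ ℝ) :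
    ∫ a, φ a ∂(empiricalMeasure u T : Measure α) =
      (∑ t ∈ Finset.range T, φ (u t)) / T := by
  rw [empiricalMeasure_toMeasure u hT, integral_map (measurable_of_finite _).aemeasurable
    φ.continuous.measurable.aestronglyMeasurable, integral_fintype (.of_finite)]
  simp only [uniformFin_real_singleton, smul_eq_mul]
  rw [← Finset.mul_sum, Finset.sum_range (fun t => φ (u t)), div_eq_inv_mul]

lemma tendsto_empiricalMeasure [TopologicalSpace α] [OpensMeasurableSpace α] {ι : Type*}
    {F : Filter ι} {T : ι → ℕ} (hT : Tendsto T F atTop) {u : ι → ℕ → α} {ν : ProbabilityMeasure α}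
    (h : ∀ φ : α →ᵇ ℝ, Tendsto (fun i => (∑ t ∈ Finset.range (T i), φ (u i t)) / (T i : ℝ)) F
      (𝓝 (∫ a, φ a ∂(ν : Measure α)))) :
    Tendsto (fun i => empiricalMeasure (u i) (T i)) F (𝓝 ν) := by
  rw [ProbabilityMeasure.tendsto_iff_forall_integral_tendsto]
  intro φ
  refine (h φ).congr' ?_
  filter_upwards [hT.eventually_ne_atTop 0] with i hi
  rw [integral_empiricalMeasure _ hi]

/-- Averages of a function of one term of a sequence and of `M` independently chosen terms of
another one are integrals for the product of the empirical measures, which depends continuously on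
its factors. -/
lemma tendsto_average_of_tendsto_empiricalMeasure {β : Type*} [MeasurableSpace β]
    [TopologicalSpace α] [SecondCountableTopology α] [TopologicalSpace.PseudoMetrizableSpace α]
    [BorelSpace α]
    [TopologicalSpace β] [SecondCountableTopology β] [TopologicalSpace.PseudoMetrizableSpace β]
    [BorelSpace β] {M : ℕ} {ι : Type*}
    {F : Filter ι} {T : ι → ℕ} (hT : Tendsto T F atTop) {u : ι → ℕ → α} {v : ι → ℕ → β}
    {ρ : ProbabilityMeasure α} {μ : ProbabilityMeasure β}
    (hu : Tendsto (fun i => empiricalMeasure (u i) (T i)) F (𝓝 ρ))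
    (hv : Tendsto (fun i => empiricalMeasure (v i) (T i)) F (𝓝 μ))
    (Φ : α × (Fin M → β) →ᵇ ℝ) :
    Tendsto (fun i => (∑ t : Fin (T i), ∑ τ : Fin M → Fin (T i),
      Φ (u i t, fun m => v i (τ m))) / (T i : ℝ) ^ (M + 1)) F
      (𝓝 (∫ a, Φ a ∂((ρ : Measure α).prod (Measure.pi fun _ : Fin M => (μ : Measure β))))) := by
  have hpi : Tendsto (fun i => ProbabilityMeasure.pi
      (fun _ : Fin M => empiricalMeasure (v i) (T i))) F
      (𝓝 (ProbabilityMeasure.pi fun _ : Fin M => μ)) :=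
    ((ProbabilityMeasure.continuous_pi (ι := Fin M) (α := fun _ => β)).tendsto _).comp
      (tendsto_pi_nhds.2 fun _ => hv)
  have hprod := (ProbabilityMeasure.continuous_prod.tendsto _).comp (hu.prodMk_nhds hpi)
  rw [ProbabilityMeasure.tendsto_iff_forall_integral_tendsto] at hprod
  refine (hprod Φ).congr' ?_
  filter_upwards [hT.eventually_ne_atTop 0] with i hi
  have : NeZero (T i) := ⟨hi⟩
  simp only [Function.comp_apply, ProbabilityMeasure.toMeasure_prod,
    ProbabilityMeasure.toMeasure_pi]
  rw [empiricalMeasure_toMeasure _ hi, empiricalMeasure_toMeasure _ hi,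
    ← Measure.pi_map_pi (f := fun (_ : Fin M) (t : Fin (T i)) => v i t)
      (fun _ => (measurable_of_finite _).aemeasurable),
    Measure.map_prod_map _ _ (measurable_of_finite _) (measurable_of_finite _),
    integral_map (measurable_of_finite _).aemeasurable
      Φ.continuous.measurable.aestronglyMeasurable, integral_fintype (.of_finite),
    Fintype.sum_prod_type, Finset.sum_div]
  refine Finset.sum_congr rfl fun t _ => ?_
  rw [Finset.sum_div]
  refine Finset.sum_congr rfl fun τ _ => ?_
  rw [← Set.singleton_prod_singleton, measureReal_prod_prod, uniformFin_real_singleton]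
  have : (Measure.pi fun _ : Fin M => uniformFin (T i)).real {τ} = ((T i : ℝ)⁻¹) ^ M := by
    rw [Measure.real, Measure.pi_singleton, ENNReal.toReal_prod]
    simp only [← Measure.real.eq_1, uniformFin_real_singleton]
    simp
  rw [this]
  simp only [Prod.map, smul_eq_mul]
  rw [inv_pow, ← mul_inv, ← pow_succ', div_eq_inv_mul]

end Empirical

/-! ### Orbits with additive noise -/

section NoisyOrbit

variable {E : Type*} [NormedAddCommGroup E] [MeasurableSpace E] [BorelSpace E]
  [SecondCountableTopology E]

/-- The conditional mean of `φ (x t, x (t+1))` given `x t`, for `x (t+1) = f (x t) + ε t` with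
noise `ε t` of law `N`, as an operator on bounded continuous functions. -/
noncomputable def condMean (f : C(E, E)) (N : Measure E) [IsProbabilityMeasure N] :
    (E × E →ᵇ ℝ) →ₗ[ℝ] (E →ᵇ ℝ) where
  toFun φ := BoundedContinuousFunction.ofNormedAddCommGroup (fun x => ∫ e, φ (x, f x + e) ∂N)
    (continuous_of_dominated (bound := fun _ => ‖φ‖)
      (fun x => (by fun_prop : Continuous fun e => φ (x, f x + e)).aestronglyMeasurable)
      (fun x => .of_forall fun e => φ.norm_coe_le_norm _) (integrable_const _)
      (.of_forall fun e => by fun_prop)) ‖φ‖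
    (fun x => by
      simpa using norm_integral_le_of_norm_le_const (μ := N)
        (.of_forall fun e => φ.norm_coe_le_norm (x, f x + e)))
  map_add' φ φ' := by
    ext x
    refine integral_add ?_ ?_
    · exact (φ.compContinuous ⟨fun e => (x, f x + e), by fun_prop⟩).integrable N
    · exact (φ'.compContinuous ⟨fun e => (x, f x + e), by fun_prop⟩).integrable N
  map_smul' c φ := by
    ext x
    exact integral_const_mul _ _

lemma condMean_apply (f : C(E, E)) (N : Measure E) [IsProbabilityMeasure N] (φ : E × E →ᵇ ℝ)
    (x : E) : condMean f N φ x = ∫ e, φ (x, f x + e) ∂N := rfl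

lemma abs_condMean_le (f : C(E, E)) (N : Measure E) [IsProbabilityMeasure N]
    (φ : E × E →ᵇ ℝ) (y : E) : |condMean f N φ y| ≤ ‖φ‖ := by
  simpa [condMean_apply] using norm_integral_le_of_norm_le_const (μ := N)
    (.of_forall fun e => φ.norm_coe_le_norm (y, f y + e))


/-- The law of `(x, f x + e)` for independent `x ∼ μ` and `e ∼ N`. -/
noncomputable def oneStepLaw (f : C(E, E)) (N μ : Measure E) : Measure (E × E) :=
  (μ.prod N).map fun p => (p.1, f p.1 + p.2)

lemma measurable_oneStep (f : C(E, E)) : Measurable fun p : E × E => (p.1, f p.1 + p.2) :=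
  (by fun_prop : Continuous fun p : E × E => (p.1, f p.1 + p.2)).measurable

instance (f : C(E, E)) (N μ : Measure E) [IsProbabilityMeasure N] [IsProbabilityMeasure μ] :
    IsProbabilityMeasure (oneStepLaw f N μ) :=
  Measure.isProbabilityMeasure_map (measurable_oneStep f).aemeasurable

lemma oneStepLaw_map_fst (f : C(E, E)) (N μ : Measure E) [IsProbabilityMeasure N]
    [IsProbabilityMeasure μ] : (oneStepLaw f N μ).map Prod.fst = μ := by
  rw [oneStepLaw, Measure.map_map measurable_fst (measurable_oneStep f)]
  exact Measure.map_fst_prod.trans (by simp)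

lemma integral_mul_oneStepLaw (f : C(E, E)) (N μ : Measure E) [IsProbabilityMeasure N]
    [IsProbabilityMeasure μ] {v : E → ℝ} (hv : Integrable v μ) (φ : E × E →ᵇ ℝ) :
    ∫ p, v p.1 * φ p ∂(oneStepLaw f N μ) = ∫ x, v x * condMean f N φ x ∂μ := by
  have hm := (measurable_oneStep f).aemeasurable (μ := μ.prod N)
  have hv1 : Integrable (fun p : E × E => v p.1) (μ.prod N) := hv.comp_fst N
  have hv2 : AEStronglyMeasurable (fun p : E × E => v p.1) (oneStepLaw f N μ) := by
    have := hv.1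
    rw [← oneStepLaw_map_fst f N μ] at this
    exact this.comp_measurable measurable_fst
  rw [oneStepLaw, integral_map hm]
  · rw [integral_prod]
    · simp only [condMean_apply, integral_const_mul]
    · refine hv1.mul_bdd (c := ‖φ‖) ?_ (.of_forall fun p => φ.norm_coe_le_norm _)
      exact (φ.continuous.measurable.comp (measurable_oneStep f)).aestronglyMeasurable
  · exact hv2.mul φ.continuous.measurable.aestronglyMeasurable

lemma integral_oneStepLaw (f : C(E, E)) (N μ : Measure E) [IsProbabilityMeasure N]
    [IsProbabilityMeasure μ] (φ : E × E →ᵇ ℝ) :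
    ∫ p, φ p ∂(oneStepLaw f N μ) = ∫ x, condMean f N φ x ∂μ := by
  simpa using integral_mul_oneStepLaw f N μ (integrable_const (1 : ℝ)) φ

variable {Ω : Type*} [MeasurableSpace Ω] {P : Measure Ω} [IsProbabilityMeasure P]

/-- A process `x (t+1) = f (x t) + ε t` in which `ε t` has law `N` and is independent of the past,
that is, of the initial state and of the earlier noise. -/
structure IsNoisyOrbit (P : Measure Ω) (f : C(E, E)) (N : Measure E) (x ε : ℕ → Ω → E) :
    Prop where
  measurable_init : Measurable (x 0)
  measurable_noise : ∀ t, Measurable (ε t)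
  map_noise : ∀ t, P.map (ε t) = N
  indep_past : ∀ t, IndepFun (fun ω => (x 0 ω, fun i : Finset.range t => ε i ω)) (ε t) P
  dynamics : ∀ t ω, x (t + 1) ω = f (x t ω) + ε t ω

namespace IsNoisyOrbit

variable {f : C(E, E)} {N : Measure E} {x ε : ℕ → Ω → E}

lemma measurable (h : IsNoisyOrbit P f N x ε) (t : ℕ) : Measurable (x t) := by
  induction t with
  | zero => exact h.measurable_init
  | succ t ih =>
    rw [show x (t + 1) = fun ω => f (x t ω) + ε t ω from funext (h.dynamics t)]
    exact (f.continuous.measurable.comp ih).add (h.measurable_noise t)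

lemma exists_eq_comp_past (h : IsNoisyOrbit P f N x ε) (t s : ℕ) (hs : s ≤ t) :
    ∃ G : E × (Finset.range t → E) → E, Measurable G ∧
      x s = G ∘ fun ω => (x 0 ω, fun i : Finset.range t => ε i ω) := by
  induction s with
  | zero => exact ⟨Prod.fst, measurable_fst, rfl⟩
  | succ s ih =>
    obtain ⟨G, hG, hx⟩ := ih (by omega)
    refine ⟨fun p => f (G p) + p.2 ⟨s, Finset.mem_range.2 hs⟩,
      (f.continuous.measurable.comp hG).add ((measurable_pi_apply _).comp measurable_snd), ?_⟩
    funext ω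
    rw [h.dynamics s ω, hx]
    rfl

/-- The difference between `φ (x t, x (t+1))` and its conditional mean given the past. -/
noncomputable def increment (f : C(E, E)) (N : Measure E) [IsProbabilityMeasure N] (x : ℕ → Ω → E)
    (φ : E × E →ᵇ ℝ) (t : ℕ) (ω : Ω) : ℝ :=
  φ (x t ω, x (t + 1) ω) - condMean f N φ (x t ω)

variable [IsProbabilityMeasure N]

lemma abs_increment_le (φ : E × E →ᵇ ℝ) (t : ℕ) (ω : Ω) :
    |increment f N x φ t ω| ≤ 2 * ‖φ‖ := by
  have h1 := φ.norm_coe_le_norm (x t ω, x (t + 1) ω)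
  have h2 := abs_condMean_le f N φ (x t ω)
  rw [Real.norm_eq_abs] at h1
  exact (abs_sub _ _).trans (by linarith)

lemma measurable_increment (h : IsNoisyOrbit P f N x ε) (φ : E × E →ᵇ ℝ) (t : ℕ) :
    Measurable (increment f N x φ t) :=
  (φ.continuous.measurable.comp ((h.measurable t).prodMk (h.measurable (t + 1)))).sub
    ((condMean f N φ).continuous.measurable.comp (h.measurable t))

lemma integrable_increment_mul (h : IsNoisyOrbit P f N x ε) (φ : E × E →ᵇ ℝ) (s t : ℕ) :
    Integrable (fun ω => increment f N x φ s ω * increment f N x φ t ω) P :=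
  .of_bound ((h.measurable_increment φ s).mul (h.measurable_increment φ t)).aestronglyMeasurable
    (2 * ‖φ‖ * (2 * ‖φ‖)) <| .of_forall fun ω => by
      rw [norm_mul]
      exact mul_le_mul (abs_increment_le φ s ω) (abs_increment_le φ t ω) (norm_nonneg _)
        (by positivity)

/-- Increments at different times are orthogonal, as those of a martingale. -/
lemma integral_increment_mul_eq_zero (h : IsNoisyOrbit P f N x ε) (φ : E × E →ᵇ ℝ) {s t : ℕ}
    (hst : s < t) :
    ∫ ω, increment f N x φ s ω * increment f N x φ t ω ∂P = 0 := by
  obtain ⟨G₁, hG₁, h₁⟩ := h.exists_eq_comp_past t s hst.le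
  obtain ⟨G₂, hG₂, h₂⟩ := h.exists_eq_comp_past t (s + 1) hst
  obtain ⟨G₃, hG₃, h₃⟩ := h.exists_eq_comp_past t t le_rfl
  have hV : Measurable fun ω => (x s ω, x (s + 1) ω, x t ω) :=
    (h.measurable s).prodMk ((h.measurable (s + 1)).prodMk (h.measurable t))
  have hind : IndepFun (fun ω => (x s ω, x (s + 1) ω, x t ω)) (ε t) P := by
    have := (h.indep_past t).comp (hG₁.prodMk (hG₂.prodMk hG₃)) measurable_id
    rw [h₁, h₂, h₃]
    exact this
  have hmap := (indepFun_iff_map_prod_eq_prod_map_map hV.aemeasurable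
    (h.measurable_noise t).aemeasurable).1 hind
  rw [h.map_noise t] at hmap
  let F : (E × E × E) × E → ℝ := fun p =>
    (φ (p.1.1, p.1.2.1) - condMean f N φ p.1.1) *
      (φ (p.1.2.2, f p.1.2.2 + p.2) - condMean f N φ p.1.2.2)
  have hF : Continuous F := by fun_prop
  have hprob : IsProbabilityMeasure (P.map fun ω => (x s ω, x (s + 1) ω, x t ω)) :=
    Measure.isProbabilityMeasure_map hV.aemeasurable
  have hbd : ∀ y z : E, |φ (y, z) - condMean f N φ y| ≤ 2 * ‖φ‖ := fun y z => by
    have h1 := φ.norm_coe_le_norm (y, z)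
    have h2 := abs_condMean_le f N φ y
    rw [Real.norm_eq_abs] at h1
    exact (abs_sub _ _).trans (by linarith)
  calc ∫ ω, increment f N x φ s ω * increment f N x φ t ω ∂P
      = ∫ ω, F ((x s ω, x (s + 1) ω, x t ω), ε t ω) ∂P := by
        simp only [increment, F, h.dynamics t]
    _ = ∫ p, F p ∂((P.map fun ω => (x s ω, x (s + 1) ω, x t ω)).prod N) := by
        rw [← hmap, integral_map (hV.prodMk (h.measurable_noise t)).aemeasurable
          hF.measurable.aestronglyMeasurable]
    _ = ∫ a, ∫ e, F (a, e) ∂N ∂(P.map fun ω => (x s ω, x (s + 1) ω, x t ω)) := by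
        refine integral_prod _ (.of_bound hF.measurable.aestronglyMeasurable
          (2 * ‖φ‖ * (2 * ‖φ‖)) (.of_forall fun p => ?_))
        rw [norm_mul]
        exact mul_le_mul (hbd _ _) (hbd _ _) (norm_nonneg _) (by positivity)
    _ = 0 := by
        refine integral_eq_zero_of_ae (.of_forall fun a => ?_)
        simp only [F, integral_const_mul, Pi.zero_apply]
        have hi : Integrable (fun e => φ (a.2.2, f a.2.2 + e)) N :=
          (φ.compContinuous ⟨fun e => (a.2.2, f a.2.2 + e), by fun_prop⟩).integrable N
        rw [integral_sub hi (integrable_const _)]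
        simp [condMean_apply]

lemma integral_sum_increment_sq_le (h : IsNoisyOrbit P f N x ε) (φ : E × E →ᵇ ℝ) (T : ℕ) :
    ∫ ω, (∑ t ∈ Finset.range T, increment f N x φ t ω) ^ 2 ∂P ≤ T * (2 * ‖φ‖) ^ 2 := by
  simp_rw [sq (∑ t ∈ Finset.range T, increment f N x φ t _), Finset.sum_mul_sum]
  rw [integral_finsetSum _ fun s _ => integrable_finsetSum _ fun t _ =>
    h.integrable_increment_mul φ s t]
  calc ∑ s ∈ Finset.range T, ∫ ω, ∑ t ∈ Finset.range T,
        increment f N x φ s ω * increment f N x φ t ω ∂P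
      ≤ ∑ s ∈ Finset.range T, (2 * ‖φ‖) ^ 2 := by
        refine Finset.sum_le_sum fun s hs => ?_
        rw [integral_finsetSum _ fun t _ => h.integrable_increment_mul φ s t,
          Finset.sum_eq_single_of_mem s hs]
        · refine (le_abs_self _).trans ?_
          have := norm_integral_le_of_norm_le_const (μ := P) (C := (2 * ‖φ‖) ^ 2)
            (f := fun ω => increment f N x φ s ω * increment f N x φ s ω)
            (.of_forall fun ω => by
              rw [norm_mul, ← sq]
              exact pow_le_pow_left₀ (norm_nonneg _) (abs_increment_le φ s ω) 2)
          simpa using this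
        · intro t _ hts
          rcases lt_or_gt_of_ne hts with hlt | hlt
          · rw [← h.integral_increment_mul_eq_zero φ hlt]
            exact integral_congr_ae (.of_forall fun ω => mul_comm _ _)
          · exact h.integral_increment_mul_eq_zero φ hlt
    _ = T * (2 * ‖φ‖) ^ 2 := by simp

lemma integrable_sum_increment (h : IsNoisyOrbit P f N x ε) (φ : E × E →ᵇ ℝ) (T : ℕ) :
    Integrable (fun ω => ∑ t ∈ Finset.range T, increment f N x φ t ω) P :=
  integrable_finsetSum _ fun t _ => .of_bound (h.measurable_increment φ t).aestronglyMeasurable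
    (2 * ‖φ‖) (.of_forall fun ω => abs_increment_le φ t ω)

/-- The averages of the increments tend to zero in mean, since their variance is `O(1/T)`. -/
lemma eventually_integral_average_increment_le (h : IsNoisyOrbit P f N x ε) (φ : E × E →ᵇ ℝ)
    {δ : ℝ} (hδ : 0 < δ) :
    ∀ᶠ T : ℕ in atTop,
      ∫ ω, |(∑ t ∈ Finset.range T, increment f N x φ t ω) / (T : ℝ)| ∂P ≤ δ := by
  have hmeas : ∀ T : ℕ, Measurable fun ω => ∑ t ∈ Finset.range T, increment f N x φ t ω :=
    fun T => Finset.measurable_sum _ fun t _ => h.measurable_increment φ t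
  have hbd : ∀ (T : ℕ) ω, |∑ t ∈ Finset.range T, increment f N x φ t ω| ≤ T * (2 * ‖φ‖) := by
    intro T ω
    refine (Finset.abs_sum_le_sum_abs _ _).trans ?_
    simpa using Finset.sum_le_sum fun t (_ : t ∈ Finset.range T) =>
      abs_increment_le (f := f) (N := N) (x := x) φ t ω
  have hint := h.integrable_sum_increment φ
  have hint2 : ∀ T : ℕ,
      Integrable (fun ω => (∑ t ∈ Finset.range T, increment f N x φ t ω) ^ 2) P :=
    fun T => .of_bound ((hmeas T).pow_const 2).aestronglyMeasurable ((T * (2 * ‖φ‖)) ^ 2)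
      (.of_forall fun ω => by
        rw [norm_pow]
        exact pow_le_pow_left₀ (norm_nonneg _) (hbd T ω) 2)
  have hlim : Tendsto (fun T : ℕ => (2 * ‖φ‖) ^ 2 / δ / (T : ℝ)) atTop (𝓝 0) :=
    tendsto_const_div_atTop_nhds_zero_nat _
  filter_upwards [hlim.eventually_le_const hδ, eventually_gt_atTop 0] with T hT hT0
  have hT0' : (0 : ℝ) < T := by exact_mod_cast hT0
  -- `|Y| ≤ δ / 2 + Y² / (2 δ)` turns the variance bound into a bound of the mean.
  calc ∫ ω, |(∑ t ∈ Finset.range T, increment f N x φ t ω) / (T : ℝ)| ∂P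
      ≤ ∫ ω, (δ / 2 + (∑ t ∈ Finset.range T, increment f N x φ t ω) ^ 2 *
          (1 / (2 * δ * T ^ 2))) ∂P := by
        refine integral_mono ((hint T).div_const _).abs
          ((integrable_const _).add ((hint2 T).mul_const _)) fun ω => ?_
        simp only [abs_div, Nat.abs_cast]
        set a := ∑ t ∈ Finset.range T, increment f N x φ t ω
        rw [← sq_abs a]
        have : δ / 2 + |a| ^ 2 * (1 / (2 * δ * T ^ 2)) - |a| / T =
            (|a| / T - δ) ^ 2 / (2 * δ) := by
          field_simp
          ring
        have h2 : 0 ≤ (|a| / T - δ) ^ 2 / (2 * δ) := by positivity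
        linarith
    _ = δ / 2 + (∫ ω, (∑ t ∈ Finset.range T, increment f N x φ t ω) ^ 2 ∂P) *
          (1 / (2 * δ * T ^ 2)) := by
        rw [integral_add (integrable_const _) ((hint2 T).mul_const _), integral_mul_const]
        simp
    _ ≤ δ / 2 + T * (2 * ‖φ‖) ^ 2 * (1 / (2 * δ * T ^ 2)) := by
        gcongr
        exact h.integral_sum_increment_sq_le φ T
    _ = δ / 2 + ((2 * ‖φ‖) ^ 2 / δ / (T : ℝ)) / 2 := by
        field_simp
    _ ≤ δ := by linarith

lemma tendsto_average_increment (h : IsNoisyOrbit P f N x ε) (φ : E × E →ᵇ ℝ) :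
    Tendsto (fun p : ℕ × Ω => (∑ t ∈ Finset.range p.1, increment f N x φ t p.2) / (p.1 : ℝ))
      (inProbability P) (𝓝 0) := by
  refine tendsto_inProbability_of_integral_le
    (F := fun T ω => (∑ t ∈ Finset.range T, increment f N x φ t ω) / (T : ℝ))
    (fun T => ((h.integrable_sum_increment φ T).div_const _).sub (integrable_const 0))
    fun δ hδ => ?_
  simpa only [sub_zero] using h.eventually_integral_average_increment_le φ hδ

end IsNoisyOrbit

end NoisyOrbit

/-! ### The law of large numbers -/

section LawOfLargeNumbers

variable {E : Type*} [NormedAddCommGroup E] [MeasurableSpace E] [BorelSpace E]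
  [SecondCountableTopology E]

/-- The function `(y, z) ↦ w z` of two points. -/
def sndFun (w : E →ᵇ ℝ) : E × E →ᵇ ℝ := w.compContinuous ⟨Prod.snd, continuous_snd⟩

/-- The coboundary `w - K w`, where `K w` is the conditional mean of `w (x (t+1))` given `x t`. -/
noncomputable def coboundary (f : C(E, E)) (N : Measure E) [IsProbabilityMeasure N] :
    (E →ᵇ ℝ) →ₗ[ℝ] (E →ᵇ ℝ) where
  toFun w := w - condMean f N (sndFun w)
  map_add' w w' := by
    rw [show sndFun (w + w') = sndFun w + sndFun w' from rfl, map_add]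
    abel
  map_smul' c w := by
    rw [show sndFun (c • w) = c • sndFun w from rfl, map_smul, RingHom.id_apply, smul_sub]

lemma coboundary_apply (f : C(E, E)) (N : Measure E) [IsProbabilityMeasure N] (w : E →ᵇ ℝ)
    (y : E) : coboundary f N w y = w y - condMean f N (sndFun w) y := rfl

lemma integral_coboundary_eq (f : C(E, E)) (N μ : Measure E) [IsProbabilityMeasure N]
    [IsProbabilityMeasure μ] (w : E →ᵇ ℝ) : ∫ y, coboundary f N w y ∂μ =
      ∫ y, w y ∂μ - ∫ y, w y ∂(oneStepLaw f N μ).map Prod.snd := by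
  simp only [coboundary_apply]
  rw [integral_sub (w.integrable μ) ((condMean f N (sndFun w)).integrable μ),
    ← integral_oneStepLaw,
    integral_map measurable_snd.aemeasurable w.continuous.measurable.aestronglyMeasurable]
  rfl

variable {f : C(E, E)} {N μ : Measure E} [IsProbabilityMeasure N] [IsProbabilityMeasure μ]

/-- A square integrable function orthogonal to all coboundaries of an invariant distribution takes
the same value at both points of almost every transition. If `μ × μ`-almost all pairs of
points are transitions, it is therefore constant, and zero if its mean is. -/
lemma eq_zero_of_orthogonal_coboundary (hinv : (oneStepLaw f N μ).map Prod.snd = μ)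
    (hac : μ.prod μ ≪ oneStepLaw f N μ) (v : Lp ℝ 2 μ)
    (hv : ∀ w : E →ᵇ ℝ,
      inner ℝ v (BoundedContinuousFunction.toLp 2 μ ℝ (coboundary f N w)) = 0)
    (hv1 : ∫ y, v y ∂μ = 0) : v = 0 := by
  set ρ := oneStepLaw f N μ with hρ
  have hfst : MeasurePreserving Prod.fst ρ μ := ⟨measurable_fst, oneStepLaw_map_fst f N μ⟩
  have hsnd : MeasurePreserving Prod.snd ρ μ := ⟨measurable_snd, hinv⟩
  set A := Lp.compMeasurePreservingₗᵢ ℝ (E := ℝ) (p := 2) Prod.fst hfst with hA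
  set B := Lp.compMeasurePreservingₗᵢ ℝ (E := ℝ) (p := 2) Prod.snd hsnd with hB
  have hAv : (A v : E × E → ℝ) =ᵐ[ρ] v ∘ Prod.fst := Lp.coeFn_compMeasurePreserving v hfst
  have hBv : ∀ u : Lp ℝ 2 μ, (B u : E × E → ℝ) =ᵐ[ρ] u ∘ Prod.snd :=
    fun u => Lp.coeFn_compMeasurePreserving u hsnd
  have hvint : Integrable v μ := (Lp.memLp v).integrable (by norm_num)
  have key : ∀ w : E →ᵇ ℝ,
      inner ℝ (B v - A v) (B (BoundedContinuousFunction.toLp 2 μ ℝ w)) = 0 := by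
    intro w
    rw [inner_sub_left, B.inner_map_map]
    have h1 : inner ℝ (A v) (B (BoundedContinuousFunction.toLp 2 μ ℝ w)) =
        inner ℝ v (BoundedContinuousFunction.toLp 2 μ ℝ (condMean f N (sndFun w))) := by
      rw [L2.inner_def, L2.inner_def]
      calc ∫ p, inner ℝ (A v p) (B (BoundedContinuousFunction.toLp 2 μ ℝ w) p) ∂ρ
          = ∫ p, v p.1 * sndFun w p ∂ρ := by
            refine integral_congr_ae ?_
            filter_upwards [hAv, hBv (BoundedContinuousFunction.toLp 2 μ ℝ w),
              hsnd.quasiMeasurePreserving.ae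
                (BoundedContinuousFunction.coeFn_toLp 2 μ ℝ w)] with p h1 h2 h3
            rw [h1, h2]
            simp only [Function.comp_apply, h3]
            simp [mul_comm, sndFun]
        _ = ∫ y, v y * condMean f N (sndFun w) y ∂μ := integral_mul_oneStepLaw f N μ hvint _
        _ = _ := by
            refine integral_congr_ae ?_
            filter_upwards [BoundedContinuousFunction.coeFn_toLp 2 μ ℝ
              (condMean f N (sndFun w))] with y hy
            rw [hy]
            simp [mul_comm]
    rw [h1, ← inner_sub_right, ← map_sub]
    exact hv w
  have key' : ∀ u : Lp ℝ 2 μ, inner ℝ (B v - A v) (B u) = 0 := by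
    have hd := BoundedContinuousFunction.toLp_denseRange (E := ℝ) (p := 2) μ ℝ (by norm_num)
    have heq : (fun u => inner ℝ (B v - A v) (B u)) = fun _ => (0 : ℝ) :=
      hd.equalizer (by fun_prop) continuous_const (funext key)
    exact congrFun heq
  have hAB : B v - A v = 0 := by
    rw [← norm_eq_zero, ← sq_eq_zero_iff]
    have h1 := norm_sub_sq_real (B v) (A v)
    have h2 := key' v
    rw [inner_sub_left, real_inner_self_eq_norm_sq, real_inner_comm] at h2
    rw [A.norm_map] at h1
    rw [B.norm_map] at h1 h2
    linarith
  have hae : ∀ᵐ p ∂(μ.prod μ), v p.1 = v p.2 := by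
    refine hac.ae_le ?_
    have := hBv v
    rw [sub_eq_zero.1 hAB] at this
    filter_upwards [hAv, this] with p h1 h2
    exact h1.symm.trans h2
  obtain ⟨y, hy⟩ := (Measure.ae_ae_of_ae_prod hae).exists
  have hc : ∫ z, v z ∂μ = v y := by
    rw [← integral_congr_ae hy]
    simp
  rw [Lp.eq_zero_iff_ae_eq_zero]
  filter_upwards [hy] with z hz
  rw [← hz, ← hc, hv1, Pi.zero_apply]

/-- Coboundaries and constants are dense in the bounded continuous functions, in mean. -/
lemma exists_coboundary_approx (hinv : (oneStepLaw f N μ).map Prod.snd = μ)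
    (hac : μ.prod μ ≪ oneStepLaw f N μ) (ϕ : E →ᵇ ℝ) {δ : ℝ} (hδ : 0 < δ) :
    ∃ (w : E →ᵇ ℝ) (c : ℝ), ∫ y, |ϕ y - c - coboundary f N w y| ∂μ ≤ δ := by
  let Λ : ((E →ᵇ ℝ) × ℝ) →ₗ[ℝ] Lp ℝ 2 μ :=
    (BoundedContinuousFunction.toLp 2 μ ℝ).toLinearMap ∘ₗ
      ((coboundary f N).coprod (LinearMap.toSpanSingleton ℝ (E →ᵇ ℝ) 1))
  have hΛ : ∀ w c, Λ (w, c) = BoundedContinuousFunction.toLp 2 μ ℝ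
      (coboundary f N w + c • (1 : E →ᵇ ℝ)) := fun w c => rfl
  have hdense : (LinearMap.range Λ).topologicalClosure = ⊤ := by
    rw [Submodule.topologicalClosure_eq_top_iff, Submodule.eq_bot_iff]
    intro v hv
    rw [Submodule.mem_orthogonal'] at hv
    refine eq_zero_of_orthogonal_coboundary hinv hac v (fun w => ?_) ?_
    · have := hv _ ⟨(w, 0), rfl⟩
      simpa [hΛ] using this
    · have := hv _ ⟨(0, 1), rfl⟩
      rw [hΛ, map_zero, zero_add, one_smul, L2.inner_def] at this
      rw [← this]
      refine integral_congr_ae ?_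
      filter_upwards [BoundedContinuousFunction.coeFn_toLp 2 μ ℝ (1 : E →ᵇ ℝ)] with y hy
      rw [hy]
      simp
  have hmem : BoundedContinuousFunction.toLp 2 μ ℝ ϕ ∈ (LinearMap.range Λ).topologicalClosure := by
    rw [hdense]
    trivial
  obtain ⟨_, ⟨⟨w, c⟩, rfl⟩, hw⟩ := Metric.mem_closure_iff.1 hmem δ hδ
  refine ⟨w, c, ?_⟩
  rw [hΛ, dist_eq_norm, ← map_sub] at hw
  set G : E →ᵇ ℝ := ϕ - (coboundary f N w + c • (1 : E →ᵇ ℝ)) with hG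
  have hGy : ∀ y, ϕ y - c - coboundary f N w y = G y := fun y => by
    simp [hG]
    ring
  simp_rw [hGy]
  have hn : ‖BoundedContinuousFunction.toLp 2 μ ℝ G‖ = (eLpNorm G 2 μ).toReal := by
    rw [Lp.norm_def]
    congr 1
    exact eLpNorm_congr_ae (BoundedContinuousFunction.coeFn_toLp 2 μ ℝ G)
  have hG2 : MemLp G 2 μ := (memLp_congr_ae (BoundedContinuousFunction.coeFn_toLp 2 μ ℝ G)).1
    (Lp.memLp _)
  calc ∫ y, |G y| ∂μ = (eLpNorm G 1 μ).toReal := by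
        rw [eLpNorm_one_eq_lintegral_enorm]
        exact integral_norm_eq_lintegral_enorm hG2.1
    _ ≤ (eLpNorm G 2 μ).toReal :=
        ENNReal.toReal_mono hG2.2.ne
          (eLpNorm_le_eLpNorm_of_exponent_le (by norm_num) hG2.1)
    _ ≤ δ := hn ▸ hw.le

variable {Ω : Type*} [MeasurableSpace Ω] {P : Measure Ω} [IsProbabilityMeasure P]
  {x ε : ℕ → Ω → E}

namespace IsNoisyOrbit

lemma integrable_comp (h : IsNoisyOrbit P f N x ε) (φ : E →ᵇ ℝ) (t : ℕ) :
    Integrable (fun ω => φ (x t ω)) P :=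
  .of_bound (φ.continuous.measurable.comp (h.measurable t)).aestronglyMeasurable ‖φ‖
    (.of_forall fun _ => φ.norm_coe_le_norm _)

lemma integrable_average (h : IsNoisyOrbit P f N x ε) (φ : E →ᵇ ℝ) (T : ℕ) :
    Integrable (fun ω => (∑ t ∈ Finset.range T, φ (x t ω)) / (T : ℝ)) P :=
  (integrable_finsetSum _ fun t _ => h.integrable_comp φ t).div_const _

/-- Sums of a coboundary along an orbit telescope, up to martingale increments. -/
lemma eventually_integral_average_coboundary_le (h : IsNoisyOrbit P f N x ε) (w : E →ᵇ ℝ)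
    {δ : ℝ} (hδ : 0 < δ) :
    ∀ᶠ T : ℕ in atTop,
      ∫ ω, |(∑ t ∈ Finset.range T, coboundary f N w (x t ω)) / (T : ℝ)| ∂P ≤ δ := by
  have hconst : Tendsto (fun T : ℕ => 2 * ‖w‖ / (T : ℝ)) atTop (𝓝 0) :=
    tendsto_const_div_atTop_nhds_zero_nat _
  filter_upwards [hconst.eventually_le_const (half_pos hδ),
    h.eventually_integral_average_increment_le (sndFun w) (half_pos hδ)] with T h1 h2
  have hi := ((h.integrable_sum_increment (sndFun w) T).div_const (T : ℝ)).abs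
  calc ∫ ω, |(∑ t ∈ Finset.range T, coboundary f N w (x t ω)) / (T : ℝ)| ∂P
      ≤ ∫ ω, (δ / 2 + |(∑ t ∈ Finset.range T, increment f N x (sndFun w) t ω) / (T : ℝ)|) ∂P := by
        refine integral_mono (h.integrable_average _ T).abs ((integrable_const _).add hi)
          fun ω => ?_
        have htel : ∑ t ∈ Finset.range T, coboundary f N w (x t ω) =
            (w (x 0 ω) - w (x T ω)) +
              ∑ t ∈ Finset.range T, increment f N x (sndFun w) t ω := by
          rw [← Finset.sum_range_sub' (fun t => w (x t ω)), ← Finset.sum_add_distrib]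
          refine Finset.sum_congr rfl fun t _ => ?_
          simp only [coboundary_apply, increment, sndFun,
            BoundedContinuousFunction.compContinuous_apply, ContinuousMap.coe_mk]
          ring
        simp only [htel, add_div]
        refine (abs_add_le _ _).trans (add_le_add_left (le_trans ?_ h1) _)
        rw [abs_div, Nat.abs_cast]
        gcongr
        have e1 := w.norm_coe_le_norm (x 0 ω)
        have e2 := w.norm_coe_le_norm (x T ω)
        rw [Real.norm_eq_abs] at e1 e2
        exact (abs_sub _ _).trans (by linarith)
    _ = δ / 2 +
        ∫ ω, |(∑ t ∈ Finset.range T, increment f N x (sndFun w) t ω) / (T : ℝ)| ∂P := by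
        rw [integral_add (integrable_const _) hi]
        simp
    _ ≤ δ := by linarith

/-- The limit of the time-averaged laws is an invariant distribution. -/
lemma oneStepLaw_map_snd (h : IsNoisyOrbit P f N x ε)
    (hlim : ∀ φ : E →ᵇ ℝ, Tendsto
      (fun T : ℕ => (∑ t ∈ Finset.range T, ∫ ω, φ (x t ω) ∂P) / (T : ℝ)) atTop
      (𝓝 (∫ y, φ y ∂μ))) :
    (oneStepLaw f N μ).map Prod.snd = μ := by
  have : IsProbabilityMeasure ((oneStepLaw f N μ).map Prod.snd) :=
    Measure.isProbabilityMeasure_map measurable_snd.aemeasurable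
  refine (ext_of_forall_integral_eq_of_IsFiniteMeasure fun w => ?_).symm
  rw [← sub_eq_zero, ← integral_coboundary_eq]
  refine tendsto_nhds_unique (hlim (coboundary f N w)) ?_
  rw [Metric.tendsto_nhds]
  intro δ hδ
  filter_upwards [h.eventually_integral_average_coboundary_le w (half_pos hδ)] with T hT
  rw [Real.dist_0_eq_abs, ← integral_finsetSum _ fun t _ => h.integrable_comp _ t, ← integral_div]
  exact (abs_integral_le_integral_abs.trans hT).trans_lt (half_lt_self hδ)

/-- The law of large numbers along an orbit started anywhere: up to a small error in mean, the
test function is a constant plus a coboundary, and averages of coboundaries telescope up to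
martingale increments. -/
lemma tendsto_average (h : IsNoisyOrbit P f N x ε)
    (hinv : (oneStepLaw f N μ).map Prod.snd = μ) (hac : μ.prod μ ≪ oneStepLaw f N μ)
    (hlim : ∀ φ : E →ᵇ ℝ, Tendsto
      (fun T : ℕ => (∑ t ∈ Finset.range T, ∫ ω, φ (x t ω) ∂P) / (T : ℝ)) atTop
      (𝓝 (∫ y, φ y ∂μ))) (ϕ : E →ᵇ ℝ) :
    Tendsto (fun p : ℕ × Ω => (∑ t ∈ Finset.range p.1, ϕ (x t p.2)) / (p.1 : ℝ))
      (inProbability P) (𝓝 (∫ y, ϕ y ∂μ)) := by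
  refine tendsto_inProbability_of_integral_le
    (F := fun T ω => (∑ t ∈ Finset.range T, ϕ (x t ω)) / (T : ℝ))
    (fun T => (h.integrable_average ϕ T).sub (integrable_const _)) fun δ hδ => ?_
  obtain ⟨w, c, hw⟩ := exists_coboundary_approx hinv hac ϕ (by linarith : 0 < δ / 4)
  set m := ∫ y, ϕ y ∂μ with hm
  let G : E →ᵇ ℝ := |ϕ - c • (1 : E →ᵇ ℝ) - coboundary f N w|
  have hG : ∀ y, G y = |ϕ y - c - coboundary f N w y| := fun y => by
    change |ϕ y - c • (1 : ℝ) - coboundary f N w y| = _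
    simp
  have hcob : ∫ y, coboundary f N w y ∂μ = 0 := by
    rw [integral_coboundary_eq, hinv, sub_self]
  have hcm : |c - m| ≤ δ / 4 := by
    refine le_trans ?_ hw
    have : ∫ y, (ϕ y - c - coboundary f N w y) ∂μ = m - c := by
      have hi : Integrable (fun y => ϕ y - c) μ := (ϕ.integrable μ).sub (integrable_const _)
      rw [integral_sub hi ((coboundary f N w).integrable μ),
        integral_sub (ϕ.integrable μ) (integrable_const _), hcob]
      simp [hm]
    rw [abs_sub_comm, ← this]
    exact abs_integral_le_integral_abs
  have hlimG := (hlim G).eventually_le_const (u := 2 * (δ / 4))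
    (by simp_rw [hG]; linarith)
  filter_upwards [hlimG, h.eventually_integral_average_coboundary_le w (by linarith : 0 < δ / 4),
    eventually_gt_atTop 0] with T h1 h2 hT
  have hT' : (0 : ℝ) < T := by exact_mod_cast hT
  have hpt : ∀ ω, |(∑ t ∈ Finset.range T, ϕ (x t ω)) / (T : ℝ) - m| ≤
      (∑ t ∈ Finset.range T, G (x t ω)) / (T : ℝ) + δ / 4 +
        |(∑ t ∈ Finset.range T, coboundary f N w (x t ω)) / (T : ℝ)| := by
    intro ω
    have hdec : (∑ t ∈ Finset.range T, ϕ (x t ω)) / (T : ℝ) - m =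
        (∑ t ∈ Finset.range T, (ϕ (x t ω) - c - coboundary f N w (x t ω))) / (T : ℝ) + (c - m) +
          (∑ t ∈ Finset.range T, coboundary f N w (x t ω)) / (T : ℝ) := by
      rw [Finset.sum_sub_distrib, Finset.sum_sub_distrib]
      simp only [Finset.sum_const, Finset.card_range, nsmul_eq_mul]
      field_simp
      ring
    rw [hdec]
    have b1 : |(∑ t ∈ Finset.range T, (ϕ (x t ω) - c - coboundary f N w (x t ω))) / (T : ℝ)| ≤
        (∑ t ∈ Finset.range T, G (x t ω)) / (T : ℝ) := by
      rw [abs_div, Nat.abs_cast]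
      gcongr
      simp only [hG]
      exact Finset.abs_sum_le_sum_abs _ _
    exact (abs_add_three _ _ _).trans (by linarith)
  have hiG : Integrable (fun ω => (∑ t ∈ Finset.range T, G (x t ω)) / (T : ℝ) + δ / 4) P :=
    (h.integrable_average G T).add (integrable_const _)
  have hic := (h.integrable_average (coboundary f N w) T).abs
  calc ∫ ω, |(∑ t ∈ Finset.range T, ϕ (x t ω)) / (T : ℝ) - m| ∂P
      ≤ ∫ ω, ((∑ t ∈ Finset.range T, G (x t ω)) / (T : ℝ) + δ / 4 +
        |(∑ t ∈ Finset.range T, coboundary f N w (x t ω)) / (T : ℝ)|) ∂P :=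
        integral_mono ((h.integrable_average ϕ T).sub (integrable_const _)).abs (hiG.add hic) hpt
    _ = (∑ t ∈ Finset.range T, ∫ ω, G (x t ω) ∂P) / (T : ℝ) + δ / 4 +
        ∫ ω, |(∑ t ∈ Finset.range T, coboundary f N w (x t ω)) / (T : ℝ)| ∂P := by
        rw [integral_add hiG hic, integral_add (h.integrable_average G T) (integrable_const _),
          integral_div, integral_finsetSum _ fun t _ => h.integrable_comp G t]
        simp
    _ ≤ δ := by linarith

lemma tendsto_average_pair (h : IsNoisyOrbit P f N x ε)
    (hinv : (oneStepLaw f N μ).map Prod.snd = μ) (hac : μ.prod μ ≪ oneStepLaw f N μ)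
    (hlim : ∀ φ : E →ᵇ ℝ, Tendsto
      (fun T : ℕ => (∑ t ∈ Finset.range T, ∫ ω, φ (x t ω) ∂P) / (T : ℝ)) atTop
      (𝓝 (∫ y, φ y ∂μ))) (φ : E × E →ᵇ ℝ) :
    Tendsto (fun p : ℕ × Ω =>
        (∑ t ∈ Finset.range p.1, φ (x t p.2, x (t + 1) p.2)) / (p.1 : ℝ))
      (inProbability P) (𝓝 (∫ y, φ y ∂(oneStepLaw f N μ))) := by
  have := (h.tendsto_average_increment φ).add
    (h.tendsto_average hinv hac hlim (condMean f N φ))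
  rw [zero_add, ← integral_oneStepLaw] at this
  refine this.congr fun p => ?_
  rw [← add_div, ← Finset.sum_add_distrib]
  simp [increment]

/-- Time averages of functions of a transition and of `M` independently chosen states. -/
lemma tendsto_average_pi (h : IsNoisyOrbit P f N x ε)
    (hinv : (oneStepLaw f N μ).map Prod.snd = μ) (hac : μ.prod μ ≪ oneStepLaw f N μ)
    (hlim : ∀ φ : E →ᵇ ℝ, Tendsto
      (fun T : ℕ => (∑ t ∈ Finset.range T, ∫ ω, φ (x t ω) ∂P) / (T : ℝ)) atTop
      (𝓝 (∫ y, φ y ∂μ))) {M : ℕ} (Φ : (E × E) × (Fin M → E) →ᵇ ℝ) :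
    Tendsto (fun p : ℕ × Ω => (∑ t : Fin p.1, ∑ τ : Fin M → Fin p.1,
        Φ ((x t p.2, x (t + 1) p.2), fun m => x (τ m) p.2)) / (p.1 : ℝ) ^ (M + 1))
      (inProbability P)
      (𝓝 (∫ a, Φ a ∂((oneStepLaw f N μ).prod (Measure.pi fun _ : Fin M => μ)))) :=
  tendsto_average_of_tendsto_empiricalMeasure tendsto_fst_inProbability
    (u := fun p t => (x t p.2, x (t + 1) p.2)) (v := fun p t => x t p.2)
    (ρ := ⟨oneStepLaw f N μ, inferInstance⟩) (μ := ⟨μ, inferInstance⟩)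
    (tendsto_empiricalMeasure tendsto_fst_inProbability
      (h.tendsto_average_pair hinv hac hlim))
    (tendsto_empiricalMeasure tendsto_fst_inProbability
      (tendsto_average (μ := μ) h hinv hac hlim)) Φ

end IsNoisyOrbit

end LawOfLargeNumbers

/-! ### Transition densities -/

section Density

lemma map_withDensity_comp {α β : Type*} [MeasurableSpace α] [MeasurableSpace β] (ν : Measure α)
    {s : α → β} (hs : Measurable s) {G : β → ℝ≥0∞} (hG : Measurable G) :
    (ν.withDensity fun a => G (s a)).map s = (ν.map s).withDensity G := by
  ext t ht
  rw [Measure.map_apply hs ht, withDensity_apply _ (hs ht), withDensity_apply _ ht,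
    setLIntegral_map ht hG hs]

/-- The density of the standard Gaussian distribution, by comparison of characteristic
functions. -/
lemma stdGaussian_eq_withDensity (V : Type*) [NormedAddCommGroup V] [InnerProductSpace ℝ V]
    [FiniteDimensional ℝ V] [MeasurableSpace V] [BorelSpace V] :
    stdGaussian V = volume.withDensity fun v =>
      ENNReal.ofReal ((2 * Real.pi) ^ (-(Module.finrank ℝ V : ℝ) / 2) *
        Real.exp (-‖v‖ ^ 2 / 2)) := by
  have hc : Continuous fun v : V => (2 * Real.pi) ^ (-(Module.finrank ℝ V : ℝ) / 2) *
      Real.exp (-‖v‖ ^ 2 / 2) := by fun_prop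
  have hint : Integrable fun v : V => (2 * Real.pi) ^ (-(Module.finrank ℝ V : ℝ) / 2) *
      Real.exp (-‖v‖ ^ 2 / 2) := by
    refine Integrable.const_mul ?_ _
    have := (GaussianFourier.integrable_cexp_neg_mul_sq_norm_add (V := V) (b := 1 / 2)
      (by norm_num) 0 0).norm
    refine this.congr (.of_forall fun v => ?_)
    simp only [Complex.norm_exp]
    congr 1
    simp [← Complex.ofReal_pow]
    ring
  have : IsFiniteMeasure ((volume : Measure V).withDensity fun v =>
      ENNReal.ofReal ((2 * Real.pi) ^ (-(Module.finrank ℝ V : ℝ) / 2) *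
        Real.exp (-‖v‖ ^ 2 / 2))) := isFiniteMeasure_withDensity_ofReal hint.2
  refine Measure.ext_of_charFun ?_
  funext t
  rw [charFun_stdGaussian, charFun_apply, integral_withDensity_eq_integral_toReal_smul
    (by fun_prop) (.of_forall fun _ => ENNReal.ofReal_lt_top)]
  have h1 := GaussianFourier.integral_cexp_neg_mul_sq_norm_add (V := V) (b := 1 / 2)
      (by norm_num) Complex.I t
  have h2 : ∀ v : V, (ENNReal.ofReal ((2 * Real.pi) ^ (-(Module.finrank ℝ V : ℝ) / 2) *
        Real.exp (-‖v‖ ^ 2 / 2))).toReal • Complex.exp (inner ℝ v t * Complex.I) =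
      ((2 * Real.pi) ^ (-(Module.finrank ℝ V : ℝ) / 2) : ℝ) *
        Complex.exp (-(1 / 2) * ‖v‖ ^ 2 + Complex.I * inner ℝ t v) := by
    intro v
    rw [ENNReal.toReal_ofReal (by positivity), Complex.real_smul, Complex.ofReal_mul, mul_assoc,
      Complex.ofReal_exp, ← Complex.exp_add, real_inner_comm]
    congr 2
    push_cast
    ring
  simp_rw [h2]
  rw [integral_const_mul, h1, ← mul_assoc]
  have h3 : (((2 * Real.pi) ^ (-(Module.finrank ℝ V : ℝ) / 2) : ℝ) : ℂ) *
      (Real.pi / (1 / 2) : ℂ) ^ (Module.finrank ℝ V / 2 : ℂ) = 1 := by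
    have : (Real.pi / (1 / 2) : ℂ) ^ (Module.finrank ℝ V / 2 : ℂ) =
        (((2 * Real.pi) ^ ((Module.finrank ℝ V : ℝ) / 2) : ℝ) : ℂ) := by
      rw [Complex.ofReal_cpow (by positivity)]
      push_cast
      congr 1
      ring
    rw [this, ← Complex.ofReal_mul, ← Real.rpow_add (by positivity), neg_div, neg_add_cancel,
      Real.rpow_zero, Complex.ofReal_one]
  rw [h3, one_mul, Complex.I_sq]
  congr 1
  ring

lemma isUnit_det_sqrt {d : ℕ} {S : Matrix (Fin d) (Fin d) ℝ} (hS : S.PosDef) :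
    IsUnit (open scoped MatrixOrder in (CFC.sqrt S)).det := by
  open scoped MatrixOrder in
  have h := congrArg Matrix.det (CFC.sqrt_mul_sqrt_self S hS.posSemidef.nonneg)
  rw [Matrix.det_mul] at h
  rw [isUnit_iff_ne_zero]
  intro h0
  rw [h0, zero_mul] at h
  exact hS.det_pos.ne h

lemma isUnit_det_invSqrt {d : ℕ} {S : Matrix (Fin d) (Fin d) ℝ} (hS : S.PosDef) :
    IsUnit (invSqrt S).det := by
  rw [invSqrt, Matrix.det_nonsing_inv]
  exact (isUnit_det_sqrt hS).ringInverse

lemma exists_multivariateGaussian_eq_withDensity {d : ℕ} {S : Matrix (Fin d) (Fin d) ℝ}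
    (hS : S.PosDef) :
    ∃ C : ℝ, 0 < C ∧ multivariateGaussian 0 S = volume.withDensity fun e =>
      ENNReal.ofReal (C * Real.exp (-‖Matrix.toEuclideanLin (invSqrt S) e‖ ^ 2 / 2)) := by
  open scoped MatrixOrder in
  set A := Matrix.toEuclideanLin (CFC.sqrt S) with hA
  have hdet : LinearMap.det A ≠ 0 := by
    rw [hA, Matrix.toEuclideanLin, Matrix.toLpLin_eq_toLin, LinearMap.det_toLin]
    exact (isUnit_det_sqrt hS).ne_zero
  have hBA : ∀ v, Matrix.toEuclideanLin (invSqrt S) (A v) = v := by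
    intro v
    simp only [hA, Matrix.toLpLin_apply, Matrix.mulVec_mulVec]
    rw [invSqrt, Matrix.nonsing_inv_mul _ (isUnit_det_sqrt hS)]
    simp
  set C₀ : ℝ := (2 * Real.pi) ^ (-(Module.finrank ℝ (EuclideanSpace ℝ (Fin d)) : ℝ) / 2)
  have hC₀ : 0 < C₀ := by positivity
  refine ⟨|(LinearMap.det A)⁻¹| * C₀, mul_pos (abs_pos.2 (inv_ne_zero hdet)) hC₀, ?_⟩
  have hAm : Measurable A := A.continuous_of_finiteDimensional.measurable
  have hBc : Continuous (Matrix.toEuclideanLin (invSqrt S)) :=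
    LinearMap.continuous_of_finiteDimensional _
  have hG : Measurable fun e : EuclideanSpace ℝ (Fin d) =>
      ENNReal.ofReal (C₀ * Real.exp (-‖Matrix.toEuclideanLin (invSqrt S) e‖ ^ 2 / 2)) := by
    refine (Continuous.measurable ?_).ennreal_ofReal
    fun_prop
  calc multivariateGaussian 0 S = (stdGaussian (EuclideanSpace ℝ (Fin d))).map A := by
        rw [multivariateGaussian]
        congr 1
        funext v
        rw [zero_add]
        rfl
    _ = (volume.withDensity fun v => ENNReal.ofReal (C₀ *
          Real.exp (-‖Matrix.toEuclideanLin (invSqrt S) (A v)‖ ^ 2 / 2))).map A := by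
        simp_rw [stdGaussian_eq_withDensity, hBA]
        rfl
    _ = _ := by
        rw [map_withDensity_comp _ hAm hG, Measure.map_linearMap_addHaar_eq_smul_addHaar _ hdet,
          withDensity_smul_measure, ← withDensity_smul _ hG]
        congr 1
        funext e
        simp only [Pi.smul_apply, smul_eq_mul, mul_assoc]
        rw [← ENNReal.ofReal_mul (abs_nonneg _)]

variable {E : Type*} [NormedAddCommGroup E] [MeasurableSpace E] [BorelSpace E]
  [SecondCountableTopology E] {f : C(E, E)} {N μ m : Measure E} [IsProbabilityMeasure μ]
  [SFinite m] [m.IsAddLeftInvariant] {κ : E → ℝ}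

lemma oneStepLaw_eq_withDensity (hκ : Continuous κ)
    (hN : N = m.withDensity fun e => ENNReal.ofReal (κ e)) :
    oneStepLaw f N μ =
      (μ.prod m).withDensity fun p => ENNReal.ofReal (κ (p.2 - f p.1)) := by
  have hshear : MeasurePreserving (fun p : E × E => (p.1, f p.1 + p.2)) (μ.prod m) (μ.prod m) :=
    (MeasurePreserving.id μ).skew_product (g := fun a b => f a + b)
      (by fun_prop) (.of_forall fun a => map_add_left_eq_self m (f a))
  have hG : Measurable fun p : E × E => ENNReal.ofReal (κ (p.2 - f p.1)) :=
    (by fun_prop : Continuous fun p : E × E => κ (p.2 - f p.1)).measurable.ennreal_ofReal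
  rw [oneStepLaw, hN, prod_withDensity_right (by fun_prop)]
  conv_rhs => rw [← hshear.map_eq, ← map_withDensity_comp _ hshear.measurable hG]
  simp

/-- An invariant density is the mean of the transition densities. -/
lemma density_eq_integral [IsProbabilityMeasure N] [m.IsOpenPosMeasure] {q : E → ℝ}
    (hκ : Continuous κ) (hκ0 : ∀ e, 0 < κ e) {B : ℝ} (hκB : ∀ e, κ e ≤ B)
    (hN : N = m.withDensity fun e => ENNReal.ofReal (κ e)) (hq : Continuous q)
    (hq0 : ∀ z, 0 ≤ q z) (hμ : μ = m.withDensity fun z => ENNReal.ofReal (q z))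
    (hinv : (oneStepLaw f N μ).map Prod.snd = μ) (z : E) :
    q z = ∫ y, κ (z - f y) ∂μ := by
  have hkint : ∀ z, Integrable (fun y => κ (z - f y)) μ := fun z =>
    .of_bound (by fun_prop : Continuous fun y => κ (z - f y)).measurable.aestronglyMeasurable B
      (.of_forall fun y => by rw [Real.norm_of_nonneg (hκ0 _).le]; exact hκB _)
  have hcont : Continuous fun z => ∫ y, κ (z - f y) ∂μ :=
    continuous_of_dominated (bound := fun _ => B) (fun z => (hkint z).1)
      (fun z => .of_forall fun y => by rw [Real.norm_of_nonneg (hκ0 _).le]; exact hκB _)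
      (integrable_const _) (.of_forall fun y => by fun_prop)
  have hG : Measurable fun p : E × E => ENNReal.ofReal (κ (p.2 - f p.1)) :=
    (by fun_prop : Continuous fun p : E × E => κ (p.2 - f p.1)).measurable.ennreal_ofReal
  have hdens : (oneStepLaw f N μ).map Prod.snd =
      m.withDensity fun z => ∫⁻ y, ENNReal.ofReal (κ (z - f y)) ∂μ := by
    ext s hs
    rw [Measure.map_apply measurable_snd hs, oneStepLaw_eq_withDensity hκ hN,
      withDensity_apply _ (measurable_snd hs), withDensity_apply _ hs,
      ← Set.univ_prod, ← Measure.prod_restrict, lintegral_prod_symm _ hG.aemeasurable,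
      Measure.restrict_univ]
  have hae : (fun z => ENNReal.ofReal (q z)) =ᵐ[m]
      fun z => ∫⁻ y, ENNReal.ofReal (κ (z - f y)) ∂μ := by
    rw [← withDensity_eq_iff (by fun_prop) hG.lintegral_prod_left'.aemeasurable, ← hdens, hinv,
      ← hμ]
    rw [← setLIntegral_univ, ← withDensity_apply _ .univ, ← hμ]
    exact measure_ne_top _ _
  have hae' : q =ᵐ[m] fun z => ∫ y, κ (z - f y) ∂μ := by
    filter_upwards [hae] with z hz
    rw [← ofReal_integral_eq_lintegral_ofReal (hkint z) (.of_forall fun y => (hκ0 _).le)] at hz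
    exact (ENNReal.ofReal_eq_ofReal_iff (hq0 z) (integral_nonneg fun y => (hκ0 _).le)).1 hz
  exact congrFun ((hq.ae_eq_iff_eq m hcont).1 hae') z

lemma density_pos [IsProbabilityMeasure N] [m.IsOpenPosMeasure] {q : E → ℝ}
    (hκ : Continuous κ) (hκ0 : ∀ e, 0 < κ e) {B : ℝ} (hκB : ∀ e, κ e ≤ B)
    (hN : N = m.withDensity fun e => ENNReal.ofReal (κ e)) (hq : Continuous q)
    (hq0 : ∀ z, 0 ≤ q z) (hμ : μ = m.withDensity fun z => ENNReal.ofReal (q z))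
    (hinv : (oneStepLaw f N μ).map Prod.snd = μ) (z : E) : 0 < q z := by
  rw [density_eq_integral hκ hκ0 hκB hN hq hq0 hμ hinv z]
  have hkint : Integrable (fun y => κ (z - f y)) μ :=
    .of_bound (by fun_prop : Continuous fun y => κ (z - f y)).measurable.aestronglyMeasurable B
      (.of_forall fun y => by rw [Real.norm_of_nonneg (hκ0 _).le]; exact hκB _)
  rw [integral_pos_iff_support_of_nonneg (fun y => (hκ0 _).le) hkint]
  have : Function.support (fun y => κ (z - f y)) = Set.univ :=
    Set.eq_univ_of_forall fun y => (hκ0 _).ne'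
  simp [this]

/-- The density of a transition relative to two independent draws from the invariant
distribution. -/
lemma oneStepLaw_eq_withDensity_prod {q : E → ℝ}
    (hκ : Continuous κ) (hN : N = m.withDensity fun e => ENNReal.ofReal (κ e))
    (hq : Continuous q) (hq0 : ∀ z, 0 < q z)
    (hμ : μ = m.withDensity fun z => ENNReal.ofReal (q z)) :
    oneStepLaw f N μ =
      (μ.prod μ).withDensity fun p => ENNReal.ofReal (κ (p.2 - f p.1) / q p.2) := by
  have hr : Continuous fun p : E × E => κ (p.2 - f p.1) / q p.2 := by
    refine Continuous.div (by fun_prop) (by fun_prop) fun p => (hq0 _).ne'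
  rw [oneStepLaw_eq_withDensity hκ hN]
  have hprod : μ.prod μ = (μ.prod m).withDensity fun p => ENNReal.ofReal (q p.2) := by
    conv_lhs => rw [hμ]
    rw [prod_withDensity_right (by fun_prop), ← hμ]
  rw [hprod, ← withDensity_mul _ (by fun_prop) (by fun_prop)]
  congr 1
  funext p
  rw [Pi.mul_apply, ← ENNReal.ofReal_mul (hq0 _).le, mul_div_cancel₀ _ (hq0 _).ne']

end Density

/-! ### The first-order condition at a minimum of the InfoNCE loss -/

section SoftmaxInequalities

variable {ι : Type*} [Fintype ι]

/-- The softmax weights of a finite family of scores. -/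
noncomputable def softmax (a : ι → ℝ) (j : ι) : ℝ := Real.exp (a j) / ∑ i, Real.exp (a i)

lemma sum_exp_pos [Nonempty ι] (a : ι → ℝ) : 0 < ∑ i, Real.exp (a i) :=
  Finset.sum_pos (fun _ _ => Real.exp_pos _) Finset.univ_nonempty

lemma softmax_pos [Nonempty ι] (a : ι → ℝ) (j : ι) : 0 < softmax a j :=
  div_pos (Real.exp_pos _) (sum_exp_pos a)

lemma sum_softmax [Nonempty ι] (a : ι → ℝ) : ∑ j, softmax a j = 1 := by
  simp_rw [softmax, ← Finset.sum_div]
  exact div_self (sum_exp_pos a).ne'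

lemma softmax_le_one [Nonempty ι] (a : ι → ℝ) (j : ι) : softmax a j ≤ 1 := by
  rw [← sum_softmax a]
  exact Finset.single_le_sum (fun i _ => (softmax_pos a i).le) (Finset.mem_univ j)

/-- The cross entropy with respect to the softmax distribution, along the direction `h`, is bounded
by its first-order expansion up to a quadratic error. -/
lemma crossEntropy_sub_le [Nonempty ι] (a h : ι → ℝ) (k : ι) {B s : ℝ} (hB : ∀ j, |h j| ≤ B)
    (hs : 0 ≤ s) (hsB : s * B ≤ 1) :
    (-(a k + s * h k) + Real.log (∑ j, Real.exp (a j + s * h j))) -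
      (-a k + Real.log (∑ j, Real.exp (a j))) ≤
        s * ∑ j, softmax a j * (h j - h k) + s ^ 2 * B ^ 2 := by
  have h1 : Real.log (∑ j, Real.exp (a j + s * h j)) - Real.log (∑ j, Real.exp (a j)) =
      Real.log (∑ j, softmax a j * Real.exp (s * h j)) := by
    rw [← Real.log_div (sum_exp_pos _).ne' (sum_exp_pos _).ne', Finset.sum_div]
    congr 1
    refine Finset.sum_congr rfl fun j _ => ?_
    rw [softmax, Real.exp_add]
    ring
  have hpos : 0 < ∑ j, softmax a j * Real.exp (s * h j) :=
    Finset.sum_pos (fun j _ => mul_pos (softmax_pos a j) (Real.exp_pos _)) Finset.univ_nonempty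
  have h2 := Real.log_le_sub_one_of_pos hpos
  have h3 : ∑ j, softmax a j * Real.exp (s * h j) ≤
      ∑ j, softmax a j * (1 + s * h j + s ^ 2 * B ^ 2) := by
    refine Finset.sum_le_sum fun j _ => mul_le_mul_of_nonneg_left ?_ (softmax_pos a j).le
    have habs : |s * h j| ≤ s * B := by
      rw [abs_mul, abs_of_nonneg hs]
      exact mul_le_mul_of_nonneg_left (hB j) hs
    have h4 := (abs_le.1 (Real.abs_exp_sub_one_sub_id_le (habs.trans hsB))).2
    have h5 : (s * h j) ^ 2 ≤ s ^ 2 * B ^ 2 := by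
      rw [← mul_pow, ← sq_abs]
      exact pow_le_pow_left₀ (abs_nonneg _) habs 2
    linarith
  have h6 : ∑ j, softmax a j * (1 + s * h j + s ^ 2 * B ^ 2) =
      1 + s * ∑ j, softmax a j * h j + s ^ 2 * B ^ 2 := by
    simp_rw [mul_add, Finset.sum_add_distrib, mul_one, ← Finset.sum_mul, sum_softmax, one_mul,
      mul_left_comm _ s, ← Finset.mul_sum]
  have h7 : ∑ j, softmax a j * (h j - h k) = ∑ j, softmax a j * h j - h k := by
    simp_rw [mul_sub, Finset.sum_sub_distrib, ← Finset.sum_mul, sum_softmax, one_mul]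
  rw [h7]
  linarith

end SoftmaxInequalities

lemma arctan_sub_mul_exp_sub_nonpos (a b : ℝ) :
    (Real.arctan a - Real.arctan b) * (Real.exp b - Real.exp a) ≤ 0 := by
  rcases le_total a b with h | h
  · exact mul_nonpos_of_nonpos_of_nonneg (sub_nonpos.2 (Real.arctan_strictMono.monotone h))
      (sub_nonneg.2 (Real.exp_le_exp.2 h))
  · exact mul_nonpos_of_nonneg_of_nonpos (sub_nonneg.2 (Real.arctan_strictMono.monotone h))
      (sub_nonpos.2 (Real.exp_le_exp.2 h))

section FirstVariation

lemma logLikelihood_eq {Y : Type*} {M : ℕ} (ψ : Y → Y → ℝ) (y : Y) (v : Fin (M + 1) → Y) :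
    -logLikelihood ψ y (v 0) (fun m => v m.succ) =
      -ψ y (v 0) + Real.log (∑ j, Real.exp (ψ y (v j))) := by
  rw [logLikelihood, Fin.sum_univ_succ]
  ring

variable {E : Type*} [TopologicalSpace E] [MeasurableSpace E] [BorelSpace E]
  [SecondCountableTopology E] {M : ℕ} {μ : Measure E} [IsProbabilityMeasure μ]

/-- The change of the InfoNCE loss of a single sample, when `η` is added to `ψ`. -/
noncomputable def lossChange (ψ η : E → E → ℝ) (a : (E × E) × (Fin M → E)) : ℝ :=
  -logLikelihood (fun y z => ψ y z + η y z) a.1.1 a.1.2 a.2 - -logLikelihood ψ a.1.1 a.1.2 a.2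

lemma continuous_lossChange {ψ η : E → E → ℝ} (hψ : Continuous (Function.uncurry ψ))
    (hη : Continuous (Function.uncurry η)) : Continuous (lossChange (M := M) ψ η) := by
  have key : ∀ {χ : E → E → ℝ}, Continuous (Function.uncurry χ) →
      Continuous fun a : (E × E) × (Fin M → E) => -logLikelihood χ a.1.1 a.1.2 a.2 := by
    intro χ hχ
    have h1 : Continuous fun a : (E × E) × (Fin M → E) => χ a.1.1 a.1.2 :=
      hχ.comp continuous_fst
    have h2 : ∀ m, Continuous fun a : (E × E) × (Fin M → E) => χ a.1.1 (a.2 m) := fun m =>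
      hχ.comp (by fun_prop : Continuous fun a : (E × E) × (Fin M → E) => (a.1.1, a.2 m))
    refine (h1.sub (Continuous.log ?_ fun a => ?_)).neg
    · exact h1.rexp.add (continuous_finsetSum _ fun m _ => (h2 m).rexp)
    · exact (add_pos_of_pos_of_nonneg (Real.exp_pos _)
        (Finset.sum_nonneg fun m _ => (Real.exp_pos _).le)).ne'
  exact (key (χ := fun y z => ψ y z + η y z) (hψ.add hη)).sub (key hψ)

lemma abs_lossChange_le {ψ η : E → E → ℝ} {B : ℝ} (hη : ∀ y z, |η y z| ≤ B)
    (a : (E × E) × (Fin M → E)) : |lossChange ψ η a| ≤ 2 * B := by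
  have hpos : ∀ χ : E → E → ℝ,
      0 < Real.exp (χ a.1.1 a.1.2) + ∑ m, Real.exp (χ a.1.1 (a.2 m)) := fun χ =>
    add_pos_of_pos_of_nonneg (Real.exp_pos _) (Finset.sum_nonneg fun m _ => (Real.exp_pos _).le)
  have key : ∀ χ ξ : E → E → ℝ, (∀ y z, χ y z ≤ B + ξ y z) →
      Real.log (Real.exp (χ a.1.1 a.1.2) + ∑ m, Real.exp (χ a.1.1 (a.2 m))) ≤
        B + Real.log (Real.exp (ξ a.1.1 a.1.2) + ∑ m, Real.exp (ξ a.1.1 (a.2 m))) := by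
    intro χ ξ h
    rw [← Real.log_exp B, ← Real.log_mul (Real.exp_pos _).ne' (hpos ξ).ne']
    refine Real.log_le_log (hpos χ) ?_
    rw [mul_add, ← Real.exp_add, Finset.mul_sum]
    simp_rw [← Real.exp_add]
    gcongr <;> exact h _ _
  have h1 := key (fun y z => ψ y z + η y z) ψ fun y z => by linarith [(abs_le.1 (hη y z)).2]
  have h2 := key ψ (fun y z => ψ y z + η y z) fun y z => by linarith [(abs_le.1 (hη y z)).1]
  have h3 := abs_le.1 (hη a.1.1 a.1.2)
  simp only [lossChange, logLikelihood]
  rw [abs_le]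
  constructor <;> linarith

/-- Among independent draws of a reference and `M + 1` examples, the first example and the others
are separated. -/
lemma measurePreserving_split (μ : Measure E) [IsProbabilityMeasure μ] :
    MeasurePreserving (fun p : E × (Fin (M + 1) → E) => ((p.1, p.2 0), fun m => p.2 (Fin.succ m)))
      (μ.prod (Measure.pi fun _ => μ)) ((μ.prod μ).prod (Measure.pi fun _ : Fin M => μ)) := by
  have h1 := measurePreserving_piFinSuccAbove (fun _ : Fin (M + 1) => μ) 0
  have h2 := (measurePreserving_prodAssoc μ μ (Measure.pi fun _ : Fin M => μ)).symm
  exact h2.comp ((MeasurePreserving.id μ).prod h1)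

lemma measurePreserving_swap (μ : Measure E) [IsProbabilityMeasure μ] (j : Fin (M + 1)) :
    MeasurePreserving
      (fun p : E × (Fin (M + 1) → E) => (p.1, fun i => p.2 (Equiv.swap 0 j i)))
      (μ.prod (Measure.pi fun _ => μ)) (μ.prod (Measure.pi fun _ => μ)) := by
  have h1 := measurePreserving_piCongrLeft (fun _ : Fin (M + 1) => μ) (Equiv.swap 0 j)
  have h2 : MeasurePreserving (fun (v : Fin (M + 1) → E) i => v (Equiv.swap 0 j i))
      (Measure.pi fun _ => μ) (Measure.pi fun _ => μ) := by
    convert h1 using 1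
    funext v i
    obtain ⟨k, rfl⟩ := (Equiv.swap 0 j).surjective i
    rw [MeasurableEquiv.coe_piCongrLeft, Equiv.piCongrLeft_apply_apply]
    simp
  exact (MeasurePreserving.id μ).prod h2

/-- **First-order condition.** Suppose that no bounded continuous perturbation of `ψ` decreases the
InfoNCE loss, for positive pairs with density `r` relative to `μ × μ`. Then `log r - ψ` depends on
the reference only. The condition is used for the perturbation `arctan (log r - ψ)`: exchanging the
positive example with a negative one shows that its derivative is an integral of terms that are
nonpositive and vanish only where `log r - ψ` agrees on the two examples. -/
lemma log_density_sub_eq_of_forall_lossChange_nonneg [μ.IsOpenPosMeasure] (hM : 1 ≤ M)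
    {ψ r : E → E → ℝ} (hψ : Continuous (Function.uncurry ψ)) (hr : Continuous (Function.uncurry r))
    (hr0 : ∀ y z, 0 < r y z) {ρ : Measure (E × E)} [IsProbabilityMeasure ρ]
    (hρ : ρ = (μ.prod μ).withDensity fun p => ENNReal.ofReal (r p.1 p.2))
    (hmin : ∀ η : E × E →ᵇ ℝ, 0 ≤ ∫ a, lossChange (M := M) ψ (fun y z => η (y, z)) a
      ∂(ρ.prod (Measure.pi fun _ => μ)))
    (y z z' : E) : Real.log (r y z) - ψ y z = Real.log (r y z') - ψ y z' := by
  set ν : Measure (E × (Fin (M + 1) → E)) := μ.prod (Measure.pi fun _ => μ) with hν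
  let u : E → E → ℝ := fun y z => Real.log (r y z) - ψ y z
  have hψ' : ∀ {X : Type _} [TopologicalSpace X] {a b : X → E}, Continuous a → Continuous b →
      Continuous fun c => ψ (a c) (b c) := fun ha hb => hψ.comp (ha.prodMk hb)
  have hr' : ∀ {X : Type _} [TopologicalSpace X] {a b : X → E}, Continuous a → Continuous b →
      Continuous fun c => r (a c) (b c) := fun ha hb => hr.comp (ha.prodMk hb)
  have hu : Continuous (Function.uncurry u) := (hr.log fun p => (hr0 _ _).ne').sub hψ
  let η : E × E →ᵇ ℝ := BoundedContinuousFunction.ofNormedAddCommGroup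
    (fun p => Real.arctan (u p.1 p.2)) (Real.continuous_arctan.comp hu) 2 fun p => by
      rw [Real.norm_eq_abs, abs_le]
      have h1 := Real.neg_pi_div_two_lt_arctan (u p.1 p.2)
      have h2 := Real.arctan_lt_pi_div_two (u p.1 p.2)
      have h3 := Real.pi_lt_four
      constructor <;> linarith
  have hη : ∀ y z, η (y, z) = Real.arctan (u y z) := fun y z => rfl
  have hηB : ∀ y z, |η (y, z)| ≤ 2 := fun y z =>
    (η.norm_coe_le_norm (y, z)).trans
      (BoundedContinuousFunction.norm_ofNormedAddCommGroup_le _ (by norm_num) _)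
  -- The weight of the example `v j` among all examples `v`, given the reference `y`.
  let w : Fin (M + 1) → E × (Fin (M + 1) → E) → ℝ := fun j p => softmax (fun i => ψ p.1 (p.2 i)) j
  let Ψ : Fin (M + 1) → E × (Fin (M + 1) → E) → ℝ :=
    fun j p => w j p * (η (p.1, p.2 j) - η (p.1, p.2 0))
  have hw : ∀ j, Continuous (w j) := fun j => by
    refine Continuous.div ?_ ?_ fun p => (sum_exp_pos _).ne'
    · exact (hψ' (by fun_prop) (by fun_prop)).rexp
    · exact continuous_finsetSum _ fun i _ => (hψ' (by fun_prop) (by fun_prop)).rexp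
  have hΨ : ∀ j, Continuous (Ψ j) := fun j => by
    have := hw j
    fun_prop
  have hΨB : ∀ j p, |Ψ j p| ≤ 4 := fun j p => by
    rw [abs_mul, abs_of_pos (softmax_pos _ j)]
    have h1 := hηB p.1 (p.2 j)
    have h2 := hηB p.1 (p.2 0)
    have h3 := abs_sub (η (p.1, p.2 j)) (η (p.1, p.2 0))
    have h4 := softmax_le_one (fun i => ψ p.1 (p.2 i)) j
    nlinarith [softmax_pos (fun i => ψ p.1 (p.2 i)) j, abs_nonneg (η (p.1, p.2 j) - η (p.1, p.2 0))]
  let c : (E × E) × (Fin M → E) → E × (Fin (M + 1) → E) := fun a => (a.1.1, Fin.cons a.1.2 a.2)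
  have hc : Continuous c := by
    refine Continuous.prodMk (by fun_prop) (continuous_pi fun i => ?_)
    refine Fin.cases ?_ (fun m => ?_) i
    · simp only [Fin.cons_zero]; fun_prop
    · simp only [Fin.cons_succ]; fun_prop
  have hΨint : ∀ j, Integrable (fun a => Ψ j (c a)) (ρ.prod (Measure.pi fun _ : Fin M => μ)) :=
    fun j => .of_bound ((hΨ j).comp hc).measurable.aestronglyMeasurable 4
      (.of_forall fun a => hΨB j _)
  -- The derivative of the loss in the direction `η` is nonnegative.
  have hD : 0 ≤ ∫ a, ∑ j, Ψ j (c a) ∂(ρ.prod (Measure.pi fun _ : Fin M => μ)) := by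
    set D := ∫ a, ∑ j, Ψ j (c a) ∂(ρ.prod (Measure.pi fun _ : Fin M => μ)) with hDdef
    have hs : ∀ s : ℝ, 0 < s → s ≤ 1 / 2 → 0 ≤ s * D + s ^ 2 * 2 ^ 2 := by
      intro s hs0 hs1
      have hi : Integrable (fun a => s * ∑ j, Ψ j (c a) + s ^ 2 * 2 ^ 2)
          (ρ.prod (Measure.pi fun _ : Fin M => μ)) :=
        ((integrable_finsetSum _ fun j _ => hΨint j).const_mul s).add (integrable_const _)
      calc 0 ≤ ∫ a, lossChange (M := M) ψ (fun y z => (s • η) (y, z)) a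
            ∂(ρ.prod (Measure.pi fun _ => μ)) := hmin (s • η)
        _ ≤ ∫ a, (s * ∑ j, Ψ j (c a) + s ^ 2 * 2 ^ 2) ∂(ρ.prod (Measure.pi fun _ => μ)) := by
            have hl : Integrable (lossChange (M := M) ψ fun y z => (s • η) (y, z))
                (ρ.prod (Measure.pi fun _ => μ)) :=
              .of_bound (continuous_lossChange (η := fun y z => (s • η) (y, z)) hψ
                (s • η).continuous).measurable.aestronglyMeasurable
                _ (.of_forall (abs_lossChange_le fun y z => (s • η).norm_coe_le_norm (y, z)))
            refine integral_mono hl hi fun a => ?_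
            have h1 := logLikelihood_eq (fun y z => ψ y z + (s • η) (y, z)) (c a).1 (c a).2
            have h2 := logLikelihood_eq ψ (c a).1 (c a).2
            simp only [c, Fin.cons_zero, Fin.cons_succ] at h1 h2
            simp only [lossChange]
            rw [h1, h2]
            have := crossEntropy_sub_le (fun j => ψ (c a).1 ((c a).2 j))
              (fun j => η ((c a).1, (c a).2 j)) 0 (fun j => hηB _ _) hs0.le (by linarith)
            simpa only [c, Fin.cons_zero, BoundedContinuousFunction.coe_smul, smul_eq_mul, Ψ, w]
              using this
        _ = s * D + s ^ 2 * 2 ^ 2 := by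
            rw [integral_add ((integrable_finsetSum _ fun j _ => hΨint j).const_mul s)
              (integrable_const _), integral_const_mul]
            simp [hDdef]
    by_contra! hneg
    have h1 := hs (min (1 / 2) (-D / 8)) (by apply lt_min <;> linarith) (min_le_left _ _)
    have h2 : 0 < min (1 / 2) (-D / 8) := by apply lt_min <;> linarith
    have h3 : min (1 / 2) (-D / 8) ≤ -D / 8 := min_le_right _ _
    nlinarith
  -- The same derivative, as an integral over independent draws of all examples.
  have hsplit := measurePreserving_split (M := M) μ
  have hrint : Integrable (fun p : E × (Fin (M + 1) → E) => r p.1 (p.2 0)) ν := by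
    have h1 : Integrable (fun p : E × E => r p.1 p.2) (μ.prod μ) := by
      refine ⟨hr.measurable.aestronglyMeasurable, ?_⟩
      rw [hasFiniteIntegral_iff_ofReal (.of_forall fun p => (hr0 _ _).le), ← setLIntegral_univ,
        ← withDensity_apply _ .univ, ← hρ]
      exact measure_lt_top _ _
    exact hsplit.integrable_comp_of_integrable (h1.comp_fst (Measure.pi fun _ : Fin M => μ))
  have hrΨ : ∀ j, Integrable (fun p => r p.1 (p.2 0) * Ψ j p) ν := fun j =>
    hrint.mul_bdd (c := 4) (hΨ j).measurable.aestronglyMeasurable (.of_forall fun p => hΨB j p)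
  have hprod : ρ.prod (Measure.pi fun _ : Fin M => μ) =
      ((μ.prod μ).prod (Measure.pi fun _ : Fin M => μ)).withDensity
        fun a => ENNReal.ofReal (r a.1.1 a.1.2) := by
    have hrm : Measurable fun p : E × E => ENNReal.ofReal (r p.1 p.2) :=
      hr.measurable.ennreal_ofReal
    rw [hρ, prod_withDensity_left hrm]
  have hDj : ∀ j, ∫ a, Ψ j (c a) ∂(ρ.prod (Measure.pi fun _ : Fin M => μ)) =
      ∫ p, r p.1 (p.2 0) * Ψ j p ∂ν := by
    intro j
    have hm : Measurable fun a : (E × E) × (Fin M → E) => ENNReal.ofReal (r a.1.1 a.1.2) :=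
      (hr.measurable.comp measurable_fst).ennreal_ofReal
    rw [hprod, integral_withDensity_eq_integral_toReal_smul hm
      (.of_forall fun _ => ENNReal.ofReal_lt_top), ← hsplit.map_eq,
      integral_map hsplit.measurable.aemeasurable]
    · refine integral_congr_ae (.of_forall fun p => ?_)
      have : c ((p.1, p.2 0), fun m => p.2 (Fin.succ m)) = p := by
        simp only [c]
        exact Prod.ext rfl (Fin.cons_self_tail p.2)
      simp only [this, smul_eq_mul]
      rw [ENNReal.toReal_ofReal (hr0 _ _).le]
    · exact (hm.ennreal_toReal.smul ((hΨ j).comp hc).measurable).aestronglyMeasurable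
  let g : Fin (M + 1) → E × (Fin (M + 1) → E) → ℝ := fun j p =>
    (η (p.1, p.2 j) - η (p.1, p.2 0)) * (w j p * r p.1 (p.2 0) - w 0 p * r p.1 (p.2 j))
  have hrexp : ∀ y z, r y z = Real.exp (ψ y z) * Real.exp (u y z) := fun y z => by
    rw [← Real.exp_add, add_sub_cancel, Real.exp_log (hr0 y z)]
  have hg : ∀ j p, g j p = Real.exp (ψ p.1 (p.2 j)) * Real.exp (ψ p.1 (p.2 0)) /
      (∑ i, Real.exp (ψ p.1 (p.2 i))) *
      ((Real.arctan (u p.1 (p.2 j)) - Real.arctan (u p.1 (p.2 0))) *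
        (Real.exp (u p.1 (p.2 0)) - Real.exp (u p.1 (p.2 j)))) := by
    intro j p
    simp only [g, w, softmax, hη, hrexp p.1 (p.2 0), hrexp p.1 (p.2 j)]
    ring
  have hgle : ∀ j p, g j p ≤ 0 := fun j p => by
    rw [hg]
    exact mul_nonpos_of_nonneg_of_nonpos
      (div_nonneg (by positivity) (sum_exp_pos _).le) (arctan_sub_mul_exp_sub_nonpos _ _)
  have hswap : ∀ j, Integrable (g j) ν ∧
      2 * ∫ p, r p.1 (p.2 0) * Ψ j p ∂ν = ∫ p, g j p ∂ν := by
    intro j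
    have hsw := measurePreserving_swap (M := M) μ j
    have h1 : ∀ p : E × (Fin (M + 1) → E), r p.1 (p.2 0) * Ψ j p +
        (fun p => r p.1 (p.2 0) * Ψ j p) (p.1, fun i => p.2 (Equiv.swap 0 j i)) = g j p := by
      intro p
      have hwsw : w j (p.1, fun i => p.2 (Equiv.swap 0 j i)) = w 0 p := by
        simp only [w, softmax, Equiv.swap_apply_right]
        congr 1
        exact Equiv.sum_comp (Equiv.swap 0 j) fun i => Real.exp (ψ p.1 (p.2 i))
      simp only [Ψ, hwsw, Equiv.swap_apply_left, Equiv.swap_apply_right, g]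
      ring
    have h2 : Integrable (fun p : E × (Fin (M + 1) → E) =>
        (fun p => r p.1 (p.2 0) * Ψ j p) (p.1, fun i => p.2 (Equiv.swap 0 j i))) ν :=
      hsw.integrable_comp_of_integrable (hrΨ j)
    refine ⟨((hrΨ j).add h2).congr (.of_forall h1), ?_⟩
    rw [← integral_congr_ae (.of_forall h1), integral_add (hrΨ j) h2, two_mul]
    congr 1
    conv_lhs => rw [hν, ← hsw.map_eq]
    rw [integral_map hsw.measurable.aemeasurable]
    rw [hsw.map_eq]
    exact (hrΨ j).1
  have hj1 : (0 : ℕ) < M := hM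
  set k : Fin (M + 1) := Fin.succ ⟨0, hj1⟩ with hk
  have hgint : ∫ p, g k p ∂ν = 0 := by
    rw [integral_finsetSum _ fun j _ => hΨint j] at hD
    simp_rw [hDj] at hD
    have hnonpos : ∀ j, ∫ p, r p.1 (p.2 0) * Ψ j p ∂ν ≤ 0 := fun j => by
      have := (hswap j).2
      have h2 : ∫ p, g j p ∂ν ≤ 0 := integral_nonpos (hgle j)
      linarith
    have hzero := (Finset.sum_eq_zero_iff_of_nonpos fun j _ => hnonpos j).1
      (le_antisymm (Finset.sum_nonpos fun j _ => hnonpos j) hD) k (Finset.mem_univ _)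
    rw [← (hswap k).2, hzero, mul_zero]
  have hgcont : Continuous (g k) := by
    have h1 := hw k
    have h2 := hw 0
    have h3 : Continuous fun p : E × (Fin (M + 1) → E) => r p.1 (p.2 k) :=
      hr' (by fun_prop) (by fun_prop)
    have h4 : Continuous fun p : E × (Fin (M + 1) → E) => r p.1 (p.2 0) :=
      hr' (by fun_prop) (by fun_prop)
    fun_prop
  have hgzero : g k = 0 := by
    have h1 : g k =ᵐ[ν] 0 := by
      have h2 := (integral_eq_zero_iff_of_nonneg (μ := ν) (f := fun p => -g k p)
        (fun p => neg_nonneg.2 (hgle k p)) (hswap k).1.neg).1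
          (by rw [integral_neg, hgint, neg_zero])
      filter_upwards [h2] with p hp
      simpa using hp
    exact (hgcont.ae_eq_iff_eq ν continuous_zero).1 h1
  have hfin := congrFun hgzero (y, Fin.cons z fun _ => z')
  rw [hg] at hfin
  simp only [Pi.zero_apply, hk, Fin.cons_zero, Fin.cons_succ] at hfin
  rcases mul_eq_zero.1 hfin with h0 | h0
  · exact absurd h0 (div_pos (by positivity) (sum_exp_pos _)).ne'
  · rcases mul_eq_zero.1 h0 with h0 | h0
    · exact (Real.arctan_injective (sub_eq_zero.1 h0)).symm
    · exact Real.exp_injective (sub_eq_zero.1 h0)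

end FirstVariation

section GlobalMinimum

variable {Ω : Type*} [MeasurableSpace Ω] {P : Measure Ω} {M : ℕ}

/-- At a global minimum, bounded continuous perturbations of `ψ` do not decrease the expected loss:
they change the empirical loss by averages of bounded continuous functions, so that the
loss of the perturbed function exists. -/
lemma integral_lossChange_nonneg {X : Type*} [TopologicalSpace X] [MeasurableSpace X]
    [BorelSpace X] [SecondCountableTopology X] [StandardBorelSpace X] {Y : Type*}
    [MeasurableSpace Y] [StandardBorelSpace Y] {g : X → Y} (hg : Function.Injective g)
    (hgm : Measurable g) {x : ℕ → Ω → X} {ρ : Measure (X × X)} {μ : Measure X}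
    (hlln : ∀ Φ : (X × X) × (Fin M → X) →ᵇ ℝ,
      Tendsto (fun p : ℕ × Ω => (∑ t : Fin p.1, ∑ τ : Fin M → Fin p.1,
        Φ ((x t p.2, x (t + 1) p.2), fun m => x (τ m) p.2)) / (p.1 : ℝ) ^ (M + 1))
      (inProbability P) (𝓝 (∫ a, Φ a ∂(ρ.prod (Measure.pi fun _ : Fin M => μ)))))
    {ψ : Y → Y → ℝ} (hψ : Continuous (Function.uncurry fun a b => ψ (g a) (g b)))
    (hmin : AttainsGlobalMinimum P M (fun t ω => g (x t ω)) ψ) (η : X × X →ᵇ ℝ) :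
    0 ≤ ∫ a, lossChange (M := M) (fun a b => ψ (g a) (g b)) (fun a b => η (a, b)) a
      ∂(ρ.prod (Measure.pi fun _ => μ)) := by
  obtain ⟨l, hl, hle⟩ := hmin
  set ψg : X → X → ℝ := fun a b => ψ (g a) (g b) with hψg
  let Φ : (X × X) × (Fin M → X) →ᵇ ℝ := BoundedContinuousFunction.ofNormedAddCommGroup
    (lossChange ψg fun a b => η (a, b))
    (continuous_lossChange (η := fun a b => η (a, b)) hψ η.continuous) _
    (abs_lossChange_le fun a b => η.norm_coe_le_norm (a, b))
  -- The perturbed function, extended by zero outside of the range of `g`.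
  have hemb : MeasurableEmbedding (Prod.map g g) :=
    (hgm.measurableEmbedding hg).prodMap (hgm.measurableEmbedding hg)
  let ψ' : Y → Y → ℝ := fun a b =>
    Function.extend (Prod.map g g) (fun p : X × X => ψg p.1 p.2 + η p) 0 (a, b)
  have hψ'm : Measurable (Function.uncurry ψ') :=
    hemb.measurable_extend (hψ.add η.continuous).measurable measurable_zero
  have hψ' : ∀ a b, ψ' (g a) (g b) = ψg a b + η (a, b) := fun a b =>
    hemb.injective.extend_apply (fun p : X × X => ψg p.1 p.2 + η p) 0 (a, b)
  have hloss : HasAsymptoticLoss P M (fun t ω => g (x t ω)) ψ'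
      (l + ∫ a, Φ a ∂(ρ.prod (Measure.pi fun _ => μ))) := by
    rw [HasAsymptoticLoss, tendstoInMeasure_const_iff] at hl ⊢
    refine (hl.add (hlln Φ)).congr fun p => ?_
    rw [infoNCELoss, infoNCELoss, ← add_div, ← Finset.sum_add_distrib]
    congr 1
    refine Finset.sum_congr rfl fun t _ => ?_
    rw [← Finset.sum_add_distrib]
    refine Finset.sum_congr rfl fun τ _ => ?_
    change _ + lossChange ψg (fun a b => η (a, b)) _ = _
    simp only [lossChange, logLikelihood, hψ', hψg]
    ring
  have := hle ψ' hψ'm _ hloss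
  have h2 : 0 ≤ ∫ a, Φ a ∂(ρ.prod (Measure.pi fun _ => μ)) := by linarith
  exact h2

end GlobalMinimum

/-! ### Rigidity of squared distances -/

section Rigidity

/-- If `‖p - z‖² - ‖F p - H z‖²` depends on `p` only, then `F` and `H` are the same isometry.
Polarization gives `⟪F p - F 0, H w - H 0⟫ = ⟪p, w⟫`, so that both maps are affine. -/
lemma exists_isometry_of_sq_dist_eq {V : Type*} [NormedAddCommGroup V] [InnerProductSpace ℝ V]
    [FiniteDimensional ℝ V] {F H : V → V} {c : V → ℝ}
    (h : ∀ p z, ‖p - z‖ ^ 2 + c p = ‖F p - H z‖ ^ 2) :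
    ∃ (Q : V ≃ₗᵢ[ℝ] V) (b : V), (∀ z, H z = Q z + b) ∧ ∀ p, F p = Q p + b := by
  set G : V → V := fun p => F p - F 0 with hG
  set K : V → V := fun w => H w - H 0 with hK
  set a : V := F 0 - H 0 with ha
  have hFH : ∀ p z, F p - H z = a + G p - K z := fun p z => by
    simp only [hG, hK, ha]
    abel
  have hpol : ∀ p w, inner ℝ (G p) (K w) = inner ℝ p w := by
    intro p w
    have e1 := h p w
    have e2 := h p 0
    have e3 := h 0 w
    have e4 := h 0 0
    have k0 : K 0 = 0 := sub_self _
    have g0 : G 0 = 0 := sub_self _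
    rw [hFH, norm_sub_sq_real, norm_sub_sq_real] at e1 e2 e3 e4
    simp only [k0, g0, inner_zero_right, inner_zero_left, add_zero, norm_zero,
      inner_add_left] at e1 e2 e3 e4
    linarith
  let e := stdOrthonormalBasis ℝ V
  have hli : LinearIndependent ℝ fun i => G (e i) := by
    rw [Fintype.linearIndependent_iff]
    intro x hx j
    have h1 : inner ℝ (∑ i, x i • G (e i)) (K (e j)) = x j := by
      rw [sum_inner]
      simp_rw [inner_smul_left, hpol, e.inner_eq_ite]
      simp
    rw [← h1, hx, inner_zero_left]
  let B := basisOfLinearIndependentOfCardEqFinrank' (fun i => G (e i)) hli (by simp)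
  have hB : ∀ i, B i = G (e i) := fun i => by simp [B]
  have hzero : ∀ v w, (∀ i, inner ℝ (G (e i)) v = inner ℝ (G (e i)) w) → v = w := fun v w hv =>
    InnerProductSpace.ext_inner_left_basis B fun i => by rw [hB, hv]
  have hadd : ∀ v w, K (v + w) = K v + K w := fun v w => hzero _ _ fun i => by
    rw [inner_add_right, hpol, hpol, hpol, inner_add_right]
  have hsmul : ∀ (r : ℝ) v, K (r • v) = r • K v := fun r v => hzero _ _ fun i => by
    rw [inner_smul_right, hpol, hpol, inner_smul_right]
  let KL : V →ₗ[ℝ] V := { toFun := K, map_add' := hadd, map_smul' := hsmul }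
  have hone : ∀ z, ‖z‖ ^ 2 = ‖K z‖ ^ 2 - 2 * inner ℝ a (K z) := by
    intro z
    have e3 := h 0 z
    have e4 := h 0 0
    have k0 : K 0 = 0 := sub_self _
    have g0 : G 0 = 0 := sub_self _
    rw [hFH, norm_sub_sq_real, norm_sub_sq_real] at e3 e4
    simp only [k0, g0, inner_zero_right, inner_zero_left, add_zero, norm_zero] at e3 e4
    linarith
  have horth : ∀ z, inner ℝ a (K z) = 0 := by
    intro z
    have e1 := hone z
    have e2 := hone (-z)
    have e3 : K (-z) = -K z := by simpa using hsmul (-1) z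
    rw [e3, norm_neg, norm_neg, inner_neg_right] at e2
    linarith
  have hnorm : ∀ z, ‖KL z‖ = ‖z‖ := fun z => by
    have e1 := hone z
    rw [horth z] at e1
    have : ‖K z‖ ^ 2 = ‖z‖ ^ 2 := by linarith
    exact (sq_eq_sq₀ (norm_nonneg _) (norm_nonneg _)).1 this
  let Q : V ≃ₗᵢ[ℝ] V := LinearIsometry.toLinearIsometryEquiv ⟨KL, hnorm⟩ rfl
  have hQ : ∀ z, Q z = K z := fun z => rfl
  have ha0 : a = 0 := by
    have := horth (Q.symm a)
    rw [← hQ, Q.apply_symm_apply] at this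
    exact inner_self_eq_zero.1 this
  refine ⟨Q, H 0, fun z => by simp [hQ, hK], fun p => ?_⟩
  have hGQ : G p = Q p := by
    refine ext_inner_right ℝ fun v => ?_
    obtain ⟨w, rfl⟩ := Q.surjective v
    rw [Q.inner_map_map, hQ, hpol]
  rw [← hGQ, ← sub_eq_zero.1 ha0]
  simp [hG]

lemma exists_orthogonal_toEuclideanLin_eq {d : ℕ}
    (Q : EuclideanSpace ℝ (Fin d) ≃ₗᵢ[ℝ] EuclideanSpace ℝ (Fin d)) :
    ∃ R ∈ Matrix.orthogonalGroup (Fin d) ℝ, ∀ v, Matrix.toEuclideanLin R v = Q v := by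
  let R := Matrix.toEuclideanLin.symm Q.toLinearEquiv.toLinearMap
  have hR : ∀ v, Matrix.toEuclideanLin R v = Q v := fun v => by
    simp [R]
  refine ⟨R, ?_, hR⟩
  rw [Matrix.mem_orthogonalGroup_iff']
  have hcol : ∀ i k, R k i = Q (EuclideanSpace.single i 1) k := fun i k => by
    rw [← hR, Matrix.toLpLin_apply]
    simp
  ext i j
  have h1 := Q.inner_map_map (EuclideanSpace.single i (1 : ℝ)) (EuclideanSpace.single j 1)
  rw [PiLp.inner_apply] at h1
  change ∑ k, R k i * R k j = (1 : Matrix (Fin d) (Fin d) ℝ) i j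
  rw [Matrix.one_apply]
  simp only [hcol]
  simp only [RCLike.inner_apply, conj_trivial] at h1
  simp_rw [mul_comm (Q (EuclideanSpace.single i 1) _), h1]
  simp [EuclideanSpace.inner_single_left]

end Rigidity

/-! ### The data-generating process -/

section DataProcess

lemma IndepFun.prodMk_left_of_prodMk_right {Ω α β γ : Type*} [MeasurableSpace Ω]
    [MeasurableSpace α] [MeasurableSpace β] [MeasurableSpace γ] {P : Measure Ω}
    [IsProbabilityMeasure P] {X : Ω → α} {Y : Ω → β} {Z : Ω → γ} (hX : Measurable X)
    (hY : Measurable Y) (hZ : Measurable Z) (h : IndepFun X (fun ω => (Y ω, Z ω)) P)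
    (hYZ : IndepFun Y Z P) : IndepFun (fun ω => (X ω, Y ω)) Z P := by
  have hXY : IndepFun X Y P := h.comp measurable_id measurable_fst
  rw [indepFun_iff_map_prod_eq_prod_map_map (hX.prodMk hY).aemeasurable hZ.aemeasurable,
    (indepFun_iff_map_prod_eq_prod_map_map hX.aemeasurable hY.aemeasurable).1 hXY]
  have := Measure.isProbabilityMeasure_map (μ := P) hX.aemeasurable
  have := Measure.isProbabilityMeasure_map (μ := P) hY.aemeasurable
  have := Measure.isProbabilityMeasure_map (μ := P) hZ.aemeasurable
  have h1 := (indepFun_iff_map_prod_eq_prod_map_map hX.aemeasurable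
    (hY.prodMk hZ).aemeasurable).1 h
  rw [(indepFun_iff_map_prod_eq_prod_map_map hY.aemeasurable hZ.aemeasurable).1 hYZ] at h1
  have h2 := (measurePreserving_prodAssoc (P.map X) (P.map Y) (P.map Z)).symm.map_eq
  rw [← h2, ← h1, Measure.map_map (MeasurableEquiv.measurable _) (hX.prodMk (hY.prodMk hZ))]
  rfl

variable {Ω : Type*} [MeasurableSpace Ω] {P : Measure Ω} [IsProbabilityMeasure P] {d D M : ℕ}
  {g : EuclideanSpace ℝ (Fin d) → EuclideanSpace ℝ (Fin D)}
  {S : Matrix (Fin d) (Fin d) ℝ} {x ε : ℕ → Ω → EuclideanSpace ℝ (Fin d)}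
  {y : ℕ → Ω → EuclideanSpace ℝ (Fin D)}

lemma DataGeneratingProcess.isNoisyOrbit
    {f : C(EuclideanSpace ℝ (Fin d), EuclideanSpace ℝ (Fin d))}
    (h : DataGeneratingProcess P f g S x ε y) :
    IsNoisyOrbit P f (multivariateGaussian 0 S) x ε where
  measurable_init := h.measurable_init
  measurable_noise := h.measurable_noise
  map_noise := h.noise_law
  indep_past t := by
    have hpast : Measurable fun ω => fun i : Finset.range t => ε i ω :=
      measurable_pi_lambda _ fun i => h.measurable_noise i
    refine IndepFun.prodMk_left_of_prodMk_right h.measurable_init hpast (h.measurable_noise t) ?_ ?_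
    · exact h.init_indep.comp (φ := id) (ψ := fun e : ℕ → EuclideanSpace ℝ (Fin d) =>
        ((fun i : Finset.range t => e i), e t)) measurable_id (by fun_prop)
    · exact (h.noise_indep.indepFun_finset (Finset.range t) {t} (by simp) h.measurable_noise).comp
        (φ := id) (ψ := fun e : ({t} : Finset ℕ) → EuclideanSpace ℝ (Fin d) =>
          e ⟨t, Finset.mem_singleton_self t⟩) measurable_id (measurable_pi_apply _)
  dynamics := h.dynamics

lemma toEuclideanLin_mul_apply (A B : Matrix (Fin d) (Fin d) ℝ) (v : EuclideanSpace ℝ (Fin d)) :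
    Matrix.toEuclideanLin (A * B) v = Matrix.toEuclideanLin A (Matrix.toEuclideanLin B v) := by
  simp [Matrix.toLpLin_apply, Matrix.mulVec_mulVec]

lemma toEuclideanLin_inv_apply_apply {A : Matrix (Fin d) (Fin d) ℝ} (hA : IsUnit A.det)
    (v : EuclideanSpace ℝ (Fin d)) :
    Matrix.toEuclideanLin A⁻¹ (Matrix.toEuclideanLin A v) = v := by
  rw [← toEuclideanLin_mul_apply, Matrix.nonsing_inv_mul _ hA]
  simp

lemma toEuclideanLin_apply_inv_apply {A : Matrix (Fin d) (Fin d) ℝ} (hA : IsUnit A.det)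
    (v : EuclideanSpace ℝ (Fin d)) :
    Matrix.toEuclideanLin A (Matrix.toEuclideanLin A⁻¹ v) = v := by
  rw [← toEuclideanLin_mul_apply, Matrix.mul_nonsing_inv _ hA]
  simp

lemma IsLimitMarginalDensity.integral_eq_one {q : EuclideanSpace ℝ (Fin d) → ℝ}
    (h : IsLimitMarginalDensity P x q) : ∫ z, q z = 1 := by
  have h1 := h.tendsto 1
  simp only [BoundedContinuousFunction.coe_one, Pi.one_apply, one_mul, integral_const,
    probReal_univ, smul_eq_mul, mul_one, Finset.sum_const, Finset.card_range,
    nsmul_eq_mul] at h1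
  refine tendsto_nhds_unique h1 (tendsto_const_nhds.congr' ?_)
  filter_upwards [eventually_ne_atTop 0] with T hT
  rw [div_self (by exact_mod_cast hT)]

/-- The limiting marginal distribution of the data, with density `q`. -/
noncomputable def marginal (q : EuclideanSpace ℝ (Fin d) → ℝ) :
    Measure (EuclideanSpace ℝ (Fin d)) :=
  volume.withDensity fun z => ENNReal.ofReal (q z)

lemma IsLimitMarginalDensity.isProbabilityMeasure {q : EuclideanSpace ℝ (Fin d) → ℝ}
    (h : IsLimitMarginalDensity P x q) : IsProbabilityMeasure (marginal q) := by
  constructor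
  have hi : Integrable q := by
    by_contra hn
    have := h.integral_eq_one
    rw [integral_undef hn] at this
    exact zero_ne_one this
  rw [marginal, withDensity_apply _ .univ, setLIntegral_univ,
    ← ofReal_integral_eq_lintegral_ofReal hi (.of_forall h.nonneg), h.integral_eq_one,
    ENNReal.ofReal_one]

lemma IsLimitMarginalDensity.tendsto_integral {q : EuclideanSpace ℝ (Fin d) → ℝ}
    (h : IsLimitMarginalDensity P x q) (φ : EuclideanSpace ℝ (Fin d) →ᵇ ℝ) :
    Tendsto (fun T : ℕ => (∑ t ∈ Finset.range T, ∫ ω, φ (x t ω) ∂P) / (T : ℝ)) atTop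
      (𝓝 (∫ z, φ z ∂(marginal q))) := by
  have hm : Measurable fun z => ENNReal.ofReal (q z) := h.continuous.measurable.ennreal_ofReal
  rw [marginal, integral_withDensity_eq_integral_toReal_smul hm
    (.of_forall fun _ => ENNReal.ofReal_lt_top)]
  refine (h.tendsto φ).trans (le_of_eq (congrArg 𝓝 (integral_congr_ae (.of_forall fun z => ?_))))
  simp only
  rw [ENNReal.toReal_ofReal (h.nonneg z), smul_eq_mul, mul_comm]

end DataProcess

/-! ### Identification of the model -/

theorem theorem1 {Ω : Type*} [MeasurableSpace Ω] (P : Measure Ω) [IsProbabilityMeasure P]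
    {d D M : ℕ} (hM : 1 ≤ M)
    (f : EuclideanSpace ℝ (Fin d) → EuclideanSpace ℝ (Fin d))
    (g : EuclideanSpace ℝ (Fin d) → EuclideanSpace ℝ (Fin D))
    (S : Matrix (Fin d) (Fin d) ℝ)
    (x ε : ℕ → Ω → EuclideanSpace ℝ (Fin d)) (y : ℕ → Ω → EuclideanSpace ℝ (Fin D))
    (hf : Function.Bijective f) (hf_cont : Continuous f)
    (hg : Function.Injective g) (hg_meas : Measurable g)
    (hS : S.PosDef)
    (hdata : DataGeneratingProcess P f g S x ε y)
    (q : EuclideanSpace ℝ (Fin d) → ℝ) (hq : IsLimitMarginalDensity P x q)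
    (h : EuclideanSpace ℝ (Fin D) → EuclideanSpace ℝ (Fin d))
    (fhat : EuclideanSpace ℝ (Fin d) → EuclideanSpace ℝ (Fin d))
    (α : EuclideanSpace ℝ (Fin D) → ℝ)
    (hhg_cont : Continuous (fun z => h (g z))) (hfhat_cont : Continuous fhat)
    (hα : ∀ z, α (g z) = Real.log (q z))
    (hmin : AttainsGlobalMinimum P M y (dclModel h fhat α)) :
    (∀ z, 0 < q z) ∧
    ∃ Q ∈ Matrix.orthogonalGroup (Fin d) ℝ, ∃ L : Matrix (Fin d) (Fin d) ℝ,
      ∃ b : EuclideanSpace ℝ (Fin d),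
      L = (Real.sqrt 2)⁻¹ • (Q * invSqrt S) ∧ IsUnit L.det ∧
      ((∀ z, h (g z) = Matrix.toEuclideanLin L z + b) ∧
        Function.Bijective (fun z => h (g z))) ∧
      (Function.Bijective fhat ∧
        ∀ z, fhat z = Matrix.toEuclideanLin L (f (Matrix.toEuclideanLin L⁻¹ (z - b))) + b) := by
  obtain ⟨C, hC, hN⟩ := exists_multivariateGaussian_eq_withDensity hS
  set B := Matrix.toEuclideanLin (invSqrt S) with hB
  have hBc : Continuous B := LinearMap.continuous_of_finiteDimensional _
  let κ : EuclideanSpace ℝ (Fin d) → ℝ := fun e => C * Real.exp (-‖B e‖ ^ 2 / 2)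
  have hκ : Continuous κ := by fun_prop
  have hκ0 : ∀ e, 0 < κ e := fun e => by positivity
  have hκC : ∀ e, κ e ≤ C := fun e => by
    refine mul_le_of_le_one_right hC.le (Real.exp_le_one_iff.2 ?_)
    have := sq_nonneg ‖B e‖
    linarith
  let fC : C(EuclideanSpace ℝ (Fin d), EuclideanSpace ℝ (Fin d)) := ⟨f, hf_cont⟩
  have horbit : IsNoisyOrbit P fC (multivariateGaussian 0 S) x ε :=
    DataGeneratingProcess.isNoisyOrbit (f := fC) hdata
  have hprob := hq.isProbabilityMeasure
  have hinv := horbit.oneStepLaw_map_snd hq.tendsto_integral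
  have hq0 : ∀ z, 0 < q z :=
    density_pos (μ := marginal q) hκ hκ0 hκC hN hq.continuous hq.nonneg rfl hinv
  refine ⟨hq0, ?_⟩
  let r : EuclideanSpace ℝ (Fin d) → EuclideanSpace ℝ (Fin d) → ℝ := fun y z => κ (z - f y) / q z
  have hr0 : ∀ y z, 0 < r y z := fun y z => div_pos (hκ0 _) (hq0 z)
  have hr : Continuous (Function.uncurry r) := by
    have := hq.continuous
    exact Continuous.div (by fun_prop) (by fun_prop) fun p => (hq0 _).ne'
  have hρ : oneStepLaw fC (multivariateGaussian 0 S) (marginal q) =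
      ((marginal q).prod (marginal q)).withDensity fun p => ENNReal.ofReal (r p.1 p.2) :=
    oneStepLaw_eq_withDensity_prod hκ hN hq.continuous hq0 rfl
  have hac : (marginal q).prod (marginal q) ≪
      oneStepLaw fC (multivariateGaussian 0 S) (marginal q) := by
    rw [hρ]
    refine withDensity_absolutelyContinuous' hr.measurable.ennreal_ofReal.aemeasurable
      (.of_forall fun p => ?_)
    simpa using hr0 p.1 p.2
  have hopen : (marginal q).IsOpenPosMeasure := by
    have hvol : volume ≪ marginal q :=
      withDensity_absolutelyContinuous' hq.continuous.measurable.ennreal_ofReal.aemeasurable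
        (.of_forall fun z => by simpa using hq0 z)
    exact hvol.isOpenPosMeasure
  have hψ : Continuous (Function.uncurry fun a b => dclModel h fhat α (g a) (g b)) := by
    simp only [dclModel, hα]
    have h1 : Continuous fun p : EuclideanSpace ℝ (Fin d) × EuclideanSpace ℝ (Fin d) =>
        fhat (h (g p.1)) := hfhat_cont.comp (hhg_cont.comp continuous_fst)
    have h2 : Continuous fun p : EuclideanSpace ℝ (Fin d) × EuclideanSpace ℝ (Fin d) =>
        h (g p.2) := hhg_cont.comp continuous_snd
    exact ((h1.sub h2).norm.pow 2).neg.sub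
      ((hq.continuous.comp continuous_snd).log fun p => (hq0 _).ne')
  have hy : y = fun t ω => g (x t ω) := funext fun t => funext fun ω => hdata.observation t ω
  rw [hy] at hmin
  have hpert := integral_lossChange_nonneg hg hg_meas
    (horbit.tendsto_average_pi hinv hac hq.tendsto_integral) hψ hmin
  have hconst := log_density_sub_eq_of_forall_lossChange_nonneg hM hψ hr hr0 hρ hpert
  have hident : ∀ y z, ‖(√2)⁻¹ • B (z - f y)‖ ^ 2 + (‖fhat (h (g y)) - h (g 0)‖ ^ 2 -
      ‖(√2)⁻¹ • B (0 - f y)‖ ^ 2) = ‖fhat (h (g y)) - h (g z)‖ ^ 2 := by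
    have hlog : ∀ y z, Real.log (r y z) - dclModel h fhat α (g y) (g z) =
        Real.log C - ‖(√2)⁻¹ • B (z - f y)‖ ^ 2 + ‖fhat (h (g y)) - h (g z)‖ ^ 2 := by
      intro y z
      rw [Real.log_div (hκ0 _).ne' (hq0 z).ne', Real.log_mul hC.ne' (Real.exp_pos _).ne',
        Real.log_exp, dclModel, hα, norm_smul, mul_pow, Real.norm_eq_abs, sq_abs, inv_pow,
        Real.sq_sqrt (by norm_num)]
      ring
    intro y z
    have := hconst y z 0
    rw [hlog, hlog] at this
    linarith
  set A : Matrix (Fin d) (Fin d) ℝ := (√2)⁻¹ • invSqrt S with hA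
  have hAdet : IsUnit A.det := by
    rw [hA, Matrix.det_smul]
    exact (IsUnit.mk0 _ (by positivity)).mul (isUnit_det_invSqrt hS)
  have hAB : ∀ v, (√2)⁻¹ • B v = Matrix.toEuclideanLin A v := fun v => by simp [hA, hB]
  let φ := Equiv.ofBijective f hf
  -- In the coordinates `A z`, the squared distances of the two models differ by a function of the
  -- reference.
  obtain ⟨Q, b, hH, hF⟩ := exists_isometry_of_sq_dist_eq
    (F := fun p => fhat (h (g (φ.symm (Matrix.toEuclideanLin A⁻¹ p)))))
    (H := fun z => h (g (Matrix.toEuclideanLin A⁻¹ z)))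
    (c := fun p => ‖fhat (h (g (φ.symm (Matrix.toEuclideanLin A⁻¹ p)))) - h (g 0)‖ ^ 2 -
      ‖(√2)⁻¹ • B (0 - f (φ.symm (Matrix.toEuclideanLin A⁻¹ p)))‖ ^ 2) (fun p z => by
      rw [← hident (φ.symm (Matrix.toEuclideanLin A⁻¹ p)) (Matrix.toEuclideanLin A⁻¹ z)]
      congr 2
      rw [hAB, map_sub, toEuclideanLin_apply_inv_apply hAdet,
        show f (φ.symm (Matrix.toEuclideanLin A⁻¹ p)) = _ from φ.apply_symm_apply _,
        toEuclideanLin_apply_inv_apply hAdet, norm_sub_rev])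
  obtain ⟨R, hR, hRQ⟩ := exists_orthogonal_toEuclideanLin_eq Q
  have hL : (√2)⁻¹ • (R * invSqrt S) = R * A := by rw [hA, Matrix.mul_smul]
  have hLdet : IsUnit (R * A).det := by
    rw [Matrix.det_mul]
    exact (Matrix.isUnit_det_of_right_inverse
      (Matrix.mem_orthogonalGroup_iff _ _ |>.1 hR)).mul hAdet
  have hLQ : ∀ v, Matrix.toEuclideanLin (R * A) v = Q (Matrix.toEuclideanLin A v) := fun v => by
    rw [toEuclideanLin_mul_apply, hRQ]
  have hHL : ∀ z, h (g z) = Matrix.toEuclideanLin (R * A) z + b := fun z => by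
    have := hH (Matrix.toEuclideanLin A z)
    rwa [toEuclideanLin_inv_apply_apply hAdet, ← hLQ] at this
  have hFL : ∀ z, fhat (h (g z)) = Matrix.toEuclideanLin (R * A) (f z) + b := fun z => by
    have := hF (Matrix.toEuclideanLin A (f z))
    rwa [toEuclideanLin_inv_apply_apply hAdet, ← hLQ,
      show φ.symm (f z) = z from φ.symm_apply_apply z] at this
  have hLbij : Function.Bijective fun v => Matrix.toEuclideanLin (R * A) v + b :=
    Function.bijective_iff_has_inverse.2 ⟨fun v => Matrix.toEuclideanLin (R * A)⁻¹ (v - b),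
      fun v => by simp only [add_sub_cancel_right]; exact toEuclideanLin_inv_apply_apply hLdet v,
      fun v => by simp only [toEuclideanLin_apply_inv_apply hLdet]; exact sub_add_cancel v b⟩
  have hHbij : Function.Bijective fun z => h (g z) := by simpa only [hHL] using hLbij
  refine ⟨R, hR, R * A, b, hL.symm, hLdet, ⟨hHL, hHbij⟩, ?_, fun z => ?_⟩
  · rw [← Function.Bijective.of_comp_iff fhat hHbij,
      show fhat ∘ (fun z => h (g z)) = (fun v => Matrix.toEuclideanLin (R * A) v + b) ∘ f from
        funext hFL]
    exact hLbij.comp hf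
  · rw [← hFL, hHL, toEuclideanLin_apply_inv_apply hLdet, sub_add_cancel]
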